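/- Let $\mathbb F$ be an algebraically closed field of characteristic $p\neq 2$, and let $\mathbb I=\mathbb Z_{\ge 0}$ if $p=0$ and $\mathbb I=\{0,1,\dots,\frac{p-1}{2}\}$ if $p\ge 3$. For $i\in\mathbb I$ put $q(i)=i(i+1)\in\mathbb F$. Let $n\ge 0$. All modules over superalgebras are $\mathbb Z_2$-graded left modules, and irreducible means nonzero with no graded submodules other than $0$ and the module itself. The affine Hecke–Clifford algebra $\mathfrak H^{\mathfrak c}_n$ is the $\mathbb F$-superalgebra with even generators $s_1,\dots,s_{n-1},x_1,\dots,x_n$ and odd generators $c_1,\dots,c_n$ subject to the relations $s_i^2=1$, $s_is_j=s_js_i$ ($|i-j|>1$), $s_is_{i+1}s_i=s_{i+1}s_is_{i+1}$; $x_ix_j=x_jx_i$; $c_i^2=1$, $c_ic_j=-c_jc_i$ ($i\ne j$); $s_ix_i=x_{i+1}s_i-(1+c_ic_{i+1})$, $s_ix_j=x_js_i$ ($j\neq i,i+1$); $s_ic_i=c_{i+1}s_i$, $s_ic_{i+1}=c_is_i$, $s_ic_j=c_js_i$ ($j\ne i,i+1$); $x_ic_i=-c_ix_i$, $x_ic_j=c_jx_i$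 ($i\neq j$). A finite dimensional $\mathfrak H^{\mathfrak c}_n$-module is integral if all eigenvalues of $x_1^2,\dots,x_n^2$ on it are of the form $q(i)$ with $i\in\mathbb I$, and completely splittable if $x_1,\dots,x_n$ act semisimply. A tuple $\underline i=(i_1,\dots,i_n)\in\mathbb I^n$ is a weight of $M$ if $M_{\underline i}=\{z\in M : (x_k^2-q(i_k))^Nz=0 \text{ for } N\gg 0,\ 1\le k\le n\}\neq 0$. Let $W(\mathfrak H^{\mathfrak c}_n)\subseteq\mathbb I^n$ be the set of all weights of irreducible completely splittable integral $\mathfrak H^{\mathfrak c}_n$-modules. The finite Hecke–Clifford algebra is $\mathcal Y_n=\mathcal C_n\rtimes\mathbb F S_n$, where $\mathcal C_n$ is the Clifford algebra with odd generators $c_1,\dots,c_n$, $c_k^2=1$, $c_kc_l=-c_lc_k$ ($k\ne l$), and $S_n$ (even) permutes the $c_k$, i.e. $\sigma c_k=c_{\sigma(k)}\sigma$. Its Jucys–Murphy elements are $L_k=\sum_{1\le j<k}(1+c_jc_k)(jk)$, $1\le k\le n$. A $\mathcal Y_n$-module is completely splittable if $L_1,\dots,L_n$ act semisimply, and $\underline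 i\in\mathbb I^n$ is a weight of a $\mathcal Y_n$-module $M$ if $\{z\in M : (L_k^2-q(i_k))^Nz=0\text{ for }N\gg0,\ 1\le k\le n\}\ne 0$. Let $W(\mathcal Y_n)$ be the set of all $\underline i\in W(\mathfrak H^{\mathfrak c}_n)$ such that $i_1=0$ (a condition that is void for $n=0$) and, as integers, $\{i_k-1,i_k+1\}\cap\{i_1,\dots,i_{k-1}\}\neq\emptyset$ for $2\le k\le n$. **Proposition.** The set of weights in $\mathbb I^n$ occurring in irreducible completely splittable $\mathcal Y_n$-modules is exactly $W(\mathcal Y_n)$. -/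

import Mathlib

universe u

namespace HeckeClifford

section Superalgebras

variable {F : Type*} [Field F]

/-- Let `A` be an algebra generated by the family `gen`, where the generator `gen g` is given the
parity `par g`.  The homogeneous part of degree `d` of the superalgebra `A` is spanned by the words
in the generators whose total parity is `d`. -/
def gradedPart {A : Type*} [Ring A] [Algebra F A] {G : Type*} (gen : G → A) (par : G → ZMod 2)
    (d : ZMod 2) : Submodule F A :=
  Submodule.span F {a | ∃ l : List G, (l.map par).sum = d ∧ a = (l.map gen).prod}

variable {A : Type*} [Ring A] [Algebra F A]
variable {M : Type*} [AddCommGroup M] [Module F M] [Module A M]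

/-- `V 0` and `V 1` are the even and odd part of a `ZMod 2`-grading which makes `M` a module over
the superalgebra `A` with homogeneous parts `𝒜 0` and `𝒜 1`. -/
structure IsSupermodule (𝒜 : ZMod 2 → Submodule F A) (V : ZMod 2 → Submodule F M) : Prop where
  isCompl : IsCompl (V 0) (V 1)
  smul_mem : ∀ (d e : ZMod 2), ∀ a ∈ 𝒜 d, ∀ v ∈ V e, a • v ∈ V (d + e)

/-- An irreducible module over a superalgebra: a nonzero graded module whose only graded
submodules are `0` and the whole module. -/
structure IsIrreducibleSupermodule (𝒜 : ZMod 2 → Submodule F A)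
    (V : ZMod 2 → Submodule F M) : Prop extends IsSupermodule 𝒜 V where
  nontrivial : Nontrivial M
  eq_bot_or_eq_top : ∀ N : Submodule A M,
    (∀ v ∈ N, ∃ v₀ ∈ V 0, ∃ v₁ ∈ V 1, v₀ ∈ N ∧ v₁ ∈ N ∧ v = v₀ + v₁) → N = ⊥ ∨ N = ⊤

variable (F M) [IsScalarTower F A M]

/-- The element `a` of the algebra acts semisimply on `M`. -/
def ActsSemisimply (a : A) : Prop :=
  Module.End.IsSemisimple (Algebra.lsmul F F M a)

variable {F}

/-- `q(i) = i(i+1)`, as an element of `F`. -/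
def q (i : ℕ) : F := (i : F) * ((i : F) + 1)

variable (F)

/-- The simultaneous generalized eigenspace of the squares `(y 0)^2, …, (y (n-1))^2` for the
eigenvalues `q (i 0), …, q (i (n-1))`. -/
def weightSpace {n : ℕ} (y : Fin n → A) (i : Fin n → ℕ) : Submodule F M :=
  ⨅ k : Fin n, Module.End.maxGenEigenspace (Algebra.lsmul F F M (y k ^ 2)) (q (i k))

end Superalgebras

/-- The index set `𝕀`: all nonnegative integers in characteristic `0`, and
`{0, 1, …, (p-1)/2}` in odd characteristic `p`. -/
def indexSet (p : ℕ) : Set ℕ := {i | p = 0 ∨ i ≤ (p - 1) / 2}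

section Affine

/-- Generators of the affine Hecke-Clifford algebra.  Indices run from `0` to `n-1`; the simple
transposition `s k` involves the positions `k` and `k+1`. -/
inductive AffineGen (n : ℕ) : Type
  | s (k : ℕ) (h : k + 1 < n) : AffineGen n
  | x (k : Fin n) : AffineGen n
  | c (k : Fin n) : AffineGen n

/-- The generators `s k` and `x k` are even, the generators `c k` are odd. -/
def AffineGen.parity {n : ℕ} : AffineGen n → ZMod 2
  | .s _ _ => 0
  | .x _ => 0
  | .c _ => 1

variable (F : Type u) [Field F] (n : ℕ)

/-- The free generator attached to `g`. -/
abbrev affineFree {F : Type u} [Field F] {n : ℕ} (g : AffineGen n) : FreeAlgebra F (AffineGen n) :=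
  FreeAlgebra.ι F g

open AffineGen in
/-- The defining relations of the affine Hecke-Clifford algebra. -/
inductive AffineRel : FreeAlgebra F (AffineGen n) → FreeAlgebra F (AffineGen n) → Prop
  | s_sq (k : ℕ) (h : k + 1 < n) :
      AffineRel (affineFree (s k h) * affineFree (s k h)) 1
  | s_comm (k l : ℕ) (hk : k + 1 < n) (hl : l + 1 < n) (hkl : k + 1 < l) :
      AffineRel (affineFree (s k hk) * affineFree (s l hl))
        (affineFree (s l hl) * affineFree (s k hk))
  | s_braid (k : ℕ) (h : k + 1 < n) (h' : k + 1 + 1 < n) :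
      AffineRel (affineFree (s k h) * affineFree (s (k + 1) h') * affineFree (s k h))
        (affineFree (s (k + 1) h') * affineFree (s k h) * affineFree (s (k + 1) h'))
  | x_comm (i j : Fin n) :
      AffineRel (affineFree (x i) * affineFree (x j)) (affineFree (x j) * affineFree (x i))
  | c_sq (i : Fin n) :
      AffineRel (affineFree (c i) * affineFree (c i)) 1
  | c_anticomm (i j : Fin n) (hij : i ≠ j) :
      AffineRel (affineFree (c i) * affineFree (c j)) (-(affineFree (c j) * affineFree (c i)))
  | s_x (k : ℕ) (h : k + 1 < n) :
      AffineRel (affineFree (s k h) * affineFree (x ⟨k, Nat.lt_of_succ_lt h⟩))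
        (affineFree (x ⟨k + 1, h⟩) * affineFree (s k h)
          - (1 + affineFree (c ⟨k, Nat.lt_of_succ_lt h⟩) * affineFree (c ⟨k + 1, h⟩)))
  | s_x_far (k : ℕ) (h : k + 1 < n) (j : Fin n) (hj : (j : ℕ) ≠ k) (hj' : (j : ℕ) ≠ k + 1) :
      AffineRel (affineFree (s k h) * affineFree (x j)) (affineFree (x j) * affineFree (s k h))
  | s_c (k : ℕ) (h : k + 1 < n) :
      AffineRel (affineFree (s k h) * affineFree (c ⟨k, Nat.lt_of_succ_lt h⟩))
        (affineFree (c ⟨k + 1, h⟩) * affineFree (s k h))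
  | s_c_succ (k : ℕ) (h : k + 1 < n) :
      AffineRel (affineFree (s k h) * affineFree (c ⟨k + 1, h⟩))
        (affineFree (c ⟨k, Nat.lt_of_succ_lt h⟩) * affineFree (s k h))
  | s_c_far (k : ℕ) (h : k + 1 < n) (j : Fin n) (hj : (j : ℕ) ≠ k) (hj' : (j : ℕ) ≠ k + 1) :
      AffineRel (affineFree (s k h) * affineFree (c j)) (affineFree (c j) * affineFree (s k h))
  | x_c_same (i : Fin n) :
      AffineRel (affineFree (x i) * affineFree (c i)) (-(affineFree (c i) * affineFree (x i)))
  | x_c_ne (i j : Fin n) (hij : i ≠ j) :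
      AffineRel (affineFree (x i) * affineFree (c j)) (affineFree (c j) * affineFree (x i))

/-- The affine Hecke-Clifford algebra (affine Sergeev algebra) over `F`. -/
abbrev AffineHeckeClifford : Type u := RingQuot (AffineRel F n)

/-- The image in the affine Hecke-Clifford algebra of a generator. -/
def affineGen (g : AffineGen n) : AffineHeckeClifford F n :=
  RingQuot.mkAlgHom F (AffineRel F n) (FreeAlgebra.ι F g)

/-- The polynomial generators of the affine Hecke-Clifford algebra. -/
def affineX (k : Fin n) : AffineHeckeClifford F n := affineGen F n (AffineGen.x k)

/-- The homogeneous parts of the superalgebra `AffineHeckeClifford F n`. -/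
def affineGrading : ZMod 2 → Submodule F (AffineHeckeClifford F n) :=
  gradedPart (affineGen F n) AffineGen.parity

/-- The set of weights of irreducible completely splittable integral modules over the affine
Hecke-Clifford algebra, in characteristic `p`.  Integral means that `M` is finite dimensional and
that all eigenvalues of all the `x k ^ 2` are of the form `q j` with `j` in the index set. -/
def affineWeights (p : ℕ) : Set (Fin n → ℕ) :=
  {i | (∀ k, i k ∈ indexSet p) ∧
    ∃ (M : Type u) (_ : AddCommGroup M) (_ : Module F M) (_ : Module (AffineHeckeClifford F n) M)
      (_ : IsScalarTower F (AffineHeckeClifford F n) M) (V : ZMod 2 → Submodule F M),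
      FiniteDimensional F M ∧
      (∀ (k : Fin n) (μ : F),
        Module.End.HasEigenvalue (Algebra.lsmul F F M (affineX F n k ^ 2)) μ →
          ∃ j ∈ indexSet p, μ = q j) ∧
      IsIrreducibleSupermodule (affineGrading F n) V ∧
      (∀ k, ActsSemisimply F M (affineX F n k)) ∧
      weightSpace F M (affineX F n) i ≠ ⊥}

end Affine

section Finite

/-- Generators of the finite Hecke-Clifford algebra: the Clifford generators `c k` and the elements
`w σ` of the symmetric group. -/
inductive FiniteGen (n : ℕ) : Type
  | c (k : Fin n) : FiniteGen n
  | w (σ : Equiv.Perm (Fin n)) : FiniteGen n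

/-- The generators `c k` are odd, the group elements `w σ` are even. -/
def FiniteGen.parity {n : ℕ} : FiniteGen n → ZMod 2
  | .c _ => 1
  | .w _ => 0

variable (F : Type u) [Field F] (n : ℕ)

/-- The free generator attached to `g`. -/
abbrev finiteFree {F : Type u} [Field F] {n : ℕ} (g : FiniteGen n) : FreeAlgebra F (FiniteGen n) :=
  FreeAlgebra.ι F g

open FiniteGen in
/-- The defining relations of the semidirect (smash) product of the Clifford algebra on
`n` generators with the group algebra of the symmetric group, the latter permuting the `c k`. -/
inductive FiniteRel : FreeAlgebra F (FiniteGen n) → FreeAlgebra F (FiniteGen n) → Prop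
  | c_sq (i : Fin n) :
      FiniteRel (finiteFree (c i) * finiteFree (c i)) 1
  | c_anticomm (i j : Fin n) (hij : i ≠ j) :
      FiniteRel (finiteFree (c i) * finiteFree (c j)) (-(finiteFree (c j) * finiteFree (c i)))
  | w_one : FiniteRel (finiteFree (w 1)) 1
  | w_mul (σ τ : Equiv.Perm (Fin n)) :
      FiniteRel (finiteFree (w (σ * τ))) (finiteFree (w σ) * finiteFree (w τ))
  | w_c (σ : Equiv.Perm (Fin n)) (i : Fin n) :
      FiniteRel (finiteFree (w σ) * finiteFree (c i)) (finiteFree (c (σ i)) * finiteFree (w σ))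

/-- The finite Hecke-Clifford (Sergeev) algebra over `F`. -/
abbrev FiniteHeckeClifford : Type u := RingQuot (FiniteRel F n)

/-- The image in the finite Hecke-Clifford algebra of a generator. -/
def finiteGen (g : FiniteGen n) : FiniteHeckeClifford F n :=
  RingQuot.mkAlgHom F (FiniteRel F n) (FreeAlgebra.ι F g)

/-- The homogeneous parts of the superalgebra `FiniteHeckeClifford F n`. -/
def finiteGrading : ZMod 2 → Submodule F (FiniteHeckeClifford F n) :=
  gradedPart (finiteGen F n) FiniteGen.parity

/-- The Jucys-Murphy element `L k`, the sum over `j < k` of `(1 + c j * c k) * (j k)`. -/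
def jucysMurphy (k : Fin n) : FiniteHeckeClifford F n :=
  ∑ j ∈ Finset.univ.filter (fun j : Fin n => j < k),
    (1 + finiteGen F n (FiniteGen.c j) * finiteGen F n (FiniteGen.c k))
      * finiteGen F n (FiniteGen.w (Equiv.swap j k))

/-- The set of weights occurring in irreducible completely splittable modules over the finite
Hecke-Clifford algebra, in characteristic `p`. -/
def weightsOfFiniteModules (p : ℕ) : Set (Fin n → ℕ) :=
  {i | (∀ k, i k ∈ indexSet p) ∧
    ∃ (M : Type u) (_ : AddCommGroup M) (_ : Module F M) (_ : Module (FiniteHeckeClifford F n) M)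
      (_ : IsScalarTower F (FiniteHeckeClifford F n) M) (V : ZMod 2 → Submodule F M),
      IsIrreducibleSupermodule (finiteGrading F n) V ∧
      (∀ k, ActsSemisimply F M (jucysMurphy F n k)) ∧
      weightSpace F M (jucysMurphy F n) i ≠ ⊥}

/-- The set `W(𝒴_n)`: those weights `i` of irreducible completely splittable modules over the
affine algebra whose first entry is `0` and such that, for every later position `k`, one of
`i k - 1`, `i k + 1` occurs among the entries before position `k`. -/
def finiteWeights (p : ℕ) : Set (Fin n → ℕ) :=
  {i | i ∈ affineWeights F n p ∧
    (∀ k : Fin n, (k : ℕ) = 0 → i k = 0) ∧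
    ∀ k : Fin n, 0 < (k : ℕ) →
      (({(i k : ℤ) - 1, (i k : ℤ) + 1} : Set ℤ) ∩
        ((fun j : Fin n => (i j : ℤ)) '' Set.Iio k)).Nonempty}

end Finite

end HeckeClifford

/-! Everything rests on two elements attached to a pair of neighbouring positions. Let x, y be the
polynomial generators there, c, d the Clifford generators and s the simple transposition. The
element `crossing` commutes with x² and y² and has square 2(x² + y²). The element `twine` = s(y² -
x²) - `crossing` exchanges x with y and c with d, and has square 2(x² + y²) - (y² - x²)². On a
simultaneous eigenspace of the squares with values a, b at the two positions, `twine` is therefore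
injective unless (a - b)² = 2(a + b); call such a, b linked. For a = q(i), b = q(j) with distinct i,
j in the index set, linked means that i and j differ by 1 (`eq_succ_of_q_linked`,
`q_linked_of_succ`). Semisimplicity of the x's forces neighbouring values to be distinct
(`lo_ne_hi`).

From the finite to the affine algebra: the Jucys-Murphy elements satisfy the relations of the x's,
so a module over the finite algebra pulls back along a surjection from the affine one. The first
Jucys-Murphy element is 0, so the first entry of a weight is 0. An entry with no neighbouring
integer before it could be moved by intertwiners past all earlier entries; at the last exchange both
entries involved would have to be 0, against distinctness (`weight_connected`). The same moves prove
integrality (`exists_q_of_hasEigenvalue`).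

From the affine to the finite algebra: for a linked pair the intertwiner squares to zero, and
instead of proving that it vanishes, the action is modified. Write s = a + p, where a preserves the
eigenspaces and p exchanges the two values, and let T be a + p on unlinked pairs and a alone on
linked ones (`IsTwist`). The T's still satisfy the Coxeter relations and the relations with the c's
and x's; the braid relation (`IsTwist.braid`) is the main computation. Hence T and c define a module
over the finite algebra. Exchanging unlinked entries preserves the connectedness condition, so the
sum `connectedPart` of the eigenspaces for connected weights is stable. There the first x is 0, and
the recursion for the Jucys-Murphy elements makes them act as the x's (`jucysMurphy_apply_eq`). An
irreducible subquotient of the submodule generated by a homogeneous weight vector is the required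
module. -/

namespace HeckeClifford

set_option linter.unusedSimpArgs false

/-! ### Rank-one identities and the intertwiner -/

section RankOne

variable {R : Type*} [Ring R]

/-- The relations between the generators of the affine Hecke-Clifford algebra which involve two
neighbouring positions. -/
structure RankOneSystem (s x y c d : R) : Prop where
  s_s : s * s = 1
  s_x : s * x = y * s - (1 + c * d)
  s_c : s * c = d * s
  s_d : s * d = c * s
  y_x : y * x = x * y
  x_c : x * c = -(c * x)
  y_d : y * d = -(d * y)
  x_d : x * d = d * x
  y_c : y * c = c * y
  c_c : c * c = 1
  d_d : d * d = 1
  d_c : d * c = -(c * d)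

/-- The element `x + y + c d (x - y)`. -/
def crossing (x y c d : R) : R := x + y + c * d * (x - y)

/-- The intertwining element attached to a pair of neighbouring positions. -/
def twine (s x y c d : R) : R := s * (y * y - x * x) - crossing x y c d

namespace RankOneSystem

variable {s x y c d : R} (h : RankOneSystem s x y c d)
include h

theorem s_y : s * y = x * s + 1 - c * d := by
  have e : s * (s * x) * s = s * (y * s - (1 + c * d)) * s := by rw [h.s_x]
  have e1 : s * (s * x) * s = x * s := by rw [← mul_assoc, h.s_s, one_mul]
  have e2 : s * (y * s - (1 + c * d)) * s = s * y - 1 - d * c := by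
    have : s * (c * d) * s = d * c := by
      rw [← mul_assoc, h.s_c, mul_assoc d, h.s_d, mul_assoc, mul_assoc, h.s_s, mul_one]
    have h2 : s * (y * s) * s = s * y := by
      rw [mul_assoc, mul_assoc, h.s_s, mul_one]
    rw [mul_sub, sub_mul, h2, mul_add, add_mul, this, mul_one, h.s_s]
    abel
  rw [e1, e2, h.d_c] at e
  rw [e]; abel

theorem s_s' (t : R) : s * (s * t) = t := by rw [← mul_assoc, h.s_s, one_mul]
theorem s_x' (t : R) : s * (x * t) = y * (s * t) - (t + c * (d * t)) := by
  rw [← mul_assoc, h.s_x]; noncomm_ring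
theorem s_y' (t : R) : s * (y * t) = x * (s * t) + t - c * (d * t) := by
  rw [← mul_assoc, h.s_y]; noncomm_ring
theorem s_c' (t : R) : s * (c * t) = d * (s * t) := by rw [← mul_assoc, h.s_c, mul_assoc]
theorem s_d' (t : R) : s * (d * t) = c * (s * t) := by rw [← mul_assoc, h.s_d, mul_assoc]
theorem y_x' (t : R) : y * (x * t) = x * (y * t) := by rw [← mul_assoc, h.y_x, mul_assoc]
theorem x_c' (t : R) : x * (c * t) = -(c * (x * t)) := by
  rw [← mul_assoc, h.x_c, neg_mul, mul_assoc]
theorem y_d' (t : R) : y * (d * t) = -(d * (y * t)) := by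
  rw [← mul_assoc, h.y_d, neg_mul, mul_assoc]
theorem x_d' (t : R) : x * (d * t) = d * (x * t) := by rw [← mul_assoc, h.x_d, mul_assoc]
theorem y_c' (t : R) : y * (c * t) = c * (y * t) := by rw [← mul_assoc, h.y_c, mul_assoc]
theorem c_c' (t : R) : c * (c * t) = t := by rw [← mul_assoc, h.c_c, one_mul]
theorem d_d' (t : R) : d * (d * t) = t := by rw [← mul_assoc, h.d_d, one_mul]
theorem d_c' (t : R) : d * (c * t) = -(c * (d * t)) := by
  rw [← mul_assoc, h.d_c, neg_mul, mul_assoc]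

theorem s_crossing : s * crossing x y c d = crossing x y c d * s := by
  simp only [crossing, mul_add, add_mul, mul_sub, sub_mul, mul_assoc, h.s_s, h.s_x, h.s_y, h.s_c,
    h.s_d, h.y_x, h.x_c, h.y_d, h.x_d, h.y_c, h.c_c, h.d_d, h.d_c, h.s_s', h.s_x', h.s_y', h.s_c',
    h.s_d', h.y_x', h.x_c', h.y_d', h.x_d', h.y_c', h.c_c', h.d_d', h.d_c', neg_mul, mul_neg,
    mul_one, one_mul, neg_neg]
  abel

theorem crossing_sq :
    crossing x y c d * crossing x y c d = 2 * (x * x + y * y) := by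
  simp only [crossing, mul_add, add_mul, mul_sub, sub_mul, mul_assoc, h.y_x, h.x_c, h.y_d, h.x_d,
    h.y_c, h.c_c, h.d_d, h.d_c, h.y_x', h.x_c', h.y_d', h.x_d', h.y_c', h.c_c', h.d_d', h.d_c',
    neg_mul, mul_neg, mul_one, one_mul, neg_neg, two_mul]
  abel

theorem s_x_sq : s * (x * x) = y * y * s - crossing x y c d := by
  simp only [crossing, mul_add, add_mul, mul_sub, sub_mul, mul_assoc, h.s_s, h.s_x, h.s_y, h.s_c,
    h.s_d, h.y_x, h.x_c, h.y_d, h.x_d, h.y_c, h.c_c, h.d_d, h.d_c, h.s_s', h.s_x', h.s_y', h.s_c',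
    h.s_d', h.y_x', h.x_c', h.y_d', h.x_d', h.y_c', h.c_c', h.d_d', h.d_c', neg_mul, mul_neg,
    mul_one, one_mul, neg_neg]
  abel

theorem crossing_x_sq : crossing x y c d * (x * x) = x * x * crossing x y c d := by
  simp only [crossing, mul_add, add_mul, mul_sub, sub_mul, mul_assoc, h.y_x, h.x_c, h.y_d, h.x_d,
    h.y_c, h.y_x', h.x_c', h.y_d', h.x_d', h.y_c', neg_mul, mul_neg, neg_neg]

theorem crossing_y_sq : crossing x y c d * (y * y) = y * y * crossing x y c d := by
  simp only [crossing, mul_add, add_mul, mul_sub, sub_mul, mul_assoc, h.y_x, h.x_c, h.y_d, h.x_d,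
    h.y_c, h.y_x', h.x_c', h.y_d', h.x_d', h.y_c', neg_mul, mul_neg, neg_neg]

theorem crossing_x :
    crossing x y c d * x = y * crossing x y c d - (1 + c * d) * (y * y - x * x) := by
  simp only [crossing, mul_add, add_mul, mul_sub, sub_mul, mul_assoc, h.y_x, h.x_c, h.y_d, h.x_d,
    h.y_c, h.y_x', h.x_c', h.y_d', h.x_d', h.y_c', neg_mul, mul_neg, neg_neg, one_mul]
  abel

theorem crossing_y :
    crossing x y c d * y = x * crossing x y c d + (1 - c * d) * (y * y - x * x) := by
  simp only [crossing, mul_add, add_mul, mul_sub, sub_mul, mul_assoc, h.y_x, h.x_c, h.y_d, h.x_d,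
    h.y_c, h.y_x', h.x_c', h.y_d', h.x_d', h.y_c', neg_mul, mul_neg, neg_neg, one_mul]
  abel

theorem crossing_c : crossing x y c d * c = d * crossing x y c d := by
  simp only [crossing, mul_add, add_mul, mul_sub, sub_mul, mul_assoc, h.y_x, h.x_c, h.y_d, h.x_d,
    h.y_c, h.c_c, h.d_d, h.d_c, h.y_x', h.x_c', h.y_d', h.x_d', h.y_c', h.c_c', h.d_d', h.d_c',
    neg_mul, mul_neg, mul_one, one_mul, neg_neg]
  abel

theorem crossing_d : crossing x y c d * d = c * crossing x y c d := by
  simp only [crossing, mul_add, add_mul, mul_sub, sub_mul, mul_assoc, h.y_x, h.x_c, h.y_d, h.x_d,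
    h.y_c, h.c_c, h.d_d, h.d_c, h.y_x', h.x_c', h.y_d', h.x_d', h.y_c', h.c_c', h.d_d', h.d_c',
    neg_mul, mul_neg, mul_one, one_mul, neg_neg]
  abel

theorem x_sq_c : x * x * c = c * (x * x) := by
  rw [mul_assoc, h.x_c, mul_neg, ← mul_assoc, h.x_c, neg_mul, neg_neg, mul_assoc]

theorem y_sq_d : y * y * d = d * (y * y) := by
  rw [mul_assoc, h.y_d, mul_neg, ← mul_assoc, h.y_d, neg_mul, neg_neg, mul_assoc]

/-- The relations `s_x` and `crossing_x` have the same error term (1 + cd)(y² - x²) once the first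
is multiplied by y² - x²; subtracting `crossing` in the definition of `twine` cancels it. -/
theorem twine_x : twine s x y c d * x = y * twine s x y c d := by
  have e : (y * y - x * x) * x = x * (y * y - x * x) := by
    simp only [mul_sub, sub_mul, mul_assoc, h.y_x, h.y_x']
  rw [twine, sub_mul, mul_assoc, e, ← mul_assoc, h.s_x, h.crossing_x]
  noncomm_ring

theorem twine_y : twine s x y c d * y = x * twine s x y c d := by
  have e : (y * y - x * x) * y = y * (y * y - x * x) := by
    simp only [mul_sub, sub_mul, mul_assoc, h.y_x, h.y_x']
  rw [twine, sub_mul, mul_assoc, e, ← mul_assoc, h.s_y, h.crossing_y]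
  noncomm_ring

theorem twine_c : twine s x y c d * c = d * twine s x y c d := by
  have e : (y * y - x * x) * c = c * (y * y - x * x) := by
    simp only [mul_sub, sub_mul, h.x_sq_c, mul_assoc, h.y_c, h.y_c']
  rw [twine, sub_mul, mul_assoc, e, ← mul_assoc, h.s_c, h.crossing_c, mul_sub d, mul_assoc]

theorem twine_d : twine s x y c d * d = c * twine s x y c d := by
  have e : (y * y - x * x) * d = d * (y * y - x * x) := by
    simp only [mul_sub, sub_mul, h.y_sq_d, mul_assoc, h.x_d, h.x_d']
  rw [twine, sub_mul, mul_assoc, e, ← mul_assoc, h.s_d, h.crossing_d, mul_sub c, mul_assoc]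

theorem twine_crossing :
    twine s x y c d * crossing x y c d = crossing x y c d * twine s x y c d := by
  have e : (y * y - x * x) * crossing x y c d = crossing x y c d * (y * y - x * x) := by
    rw [mul_sub, sub_mul, h.crossing_x_sq, h.crossing_y_sq]
  rw [twine, sub_mul, mul_assoc, e, ← mul_assoc, h.s_crossing,
    mul_sub (crossing x y c d), mul_assoc]

theorem twine_x_sq : twine s x y c d * (x * x) = y * y * twine s x y c d := by
  rw [← mul_assoc, h.twine_x, mul_assoc, h.twine_x, mul_assoc]

theorem twine_y_sq : twine s x y c d * (y * y) = x * x * twine s x y c d := by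
  rw [← mul_assoc, h.twine_y, mul_assoc, h.twine_y, mul_assoc]

/-- Since `twine` exchanges x² and y², it anticommutes with y² - x²; after this sign change only s²
= 1 and `crossing_sq` are needed. -/
theorem twine_sq : twine s x y c d * twine s x y c d
    = 2 * (x * x + y * y) - (y * y - x * x) * (y * y - x * x) := by
  have e : (y * y - x * x) * twine s x y c d = - (twine s x y c d * (y * y - x * x)) := by
    rw [sub_mul, mul_sub, h.twine_x_sq, h.twine_y_sq, neg_sub]
  have e2 : s * twine s x y c d = (y * y - x * x) - crossing x y c d * s := by
    rw [twine, mul_sub, h.s_s', h.s_crossing]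
  have e3 : twine s x y c d * twine s x y c d = s * ((y * y - x * x) * twine s x y c d)
      - crossing x y c d * twine s x y c d := by
    conv_lhs => enter [1]; rw [twine]
    rw [sub_mul, mul_assoc]
  rw [e3, e, mul_neg, ← mul_assoc, e2, sub_mul, twine, mul_sub (crossing x y c d), h.crossing_sq]
  noncomm_ring

end RankOneSystem

end RankOne

/-! ### The Coxeter presentation of the symmetric group -/

section CoxeterPresentation

/-- The product `t (m - i + 1) ⋯ t m` of `i` factors. -/
def cosetRep {H : Type*} [Monoid H] (t : ℕ → H) (m : ℕ) : ℕ → H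
  | 0 => 1
  | i + 1 => t (m - i) * cosetRep t m i

variable {H : Type*} [Monoid H] {t : ℕ → H} {N : ℕ}

theorem mul_cosetRep_of_lt (comm : ∀ k l, k + 1 < l → l < N → t k * t l = t l * t k)
    {m : ℕ} (hm : m < N) (i k : ℕ) (hk : k + i < m) :
    t k * cosetRep t m i = cosetRep t m i * t k := by
  induction i with
  | zero => simp [cosetRep]
  | succ i ih =>
    rw [cosetRep, ← mul_assoc, comm k (m - i) (by omega) (by omega), mul_assoc,
      ih (by omega), mul_assoc]

/-- The hypothesis on k says that t k is a factor of the product other than the first. It commutes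
past the factors on the left until one braid relation applies, and the resulting t (k - 1) commutes
past the rest. -/
theorem mul_cosetRep_of_gt (comm : ∀ k l, k + 1 < l → l < N → t k * t l = t l * t k)
    (braid : ∀ k, k + 1 < N → t k * t (k + 1) * t k = t (k + 1) * t k * t (k + 1))
    {m : ℕ} (hm : m < N) (i k : ℕ) (hi : i ≤ m + 1) (hkm : k ≤ m) (hk : m + 1 < k + i) :
    t k * cosetRep t m i = cosetRep t m i * t (k - 1) := by
  induction i using Nat.strong_induction_on with
  | _ i ih =>
    match i, hi, hk, ih with
    | 0, _, hk, _ => omega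
    | 1, _, hk, _ => omega
    | i + 2, hi, hk, ih =>
      by_cases hk2 : m + 1 < k + (i + 1)
      · rw [cosetRep, ← mul_assoc, ← comm (m - (i + 1)) k (by omega) (by omega), mul_assoc,
          ih (i + 1) (by omega) (by omega) hk2, mul_assoc]
      · obtain ⟨j, rfl⟩ : ∃ j, k = j + 1 := ⟨k - 1, by omega⟩
        have h1 : m - (i + 1) = j := by omega
        have h2 : m - i = j + 1 := by omega
        have h3 := mul_cosetRep_of_lt comm hm i j (by omega)
        simp only [cosetRep, h1, h2, Nat.add_sub_cancel]
        rw [mul_assoc, mul_assoc, ← h3]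
        simp only [← mul_assoc]
        rw [braid j (by omega)]

/-- Multiplying a coset representative on the left by t k has four outcomes: t k passes through
unchanged, lengthens the product, cancels its first factor, or passes through as t (k - 1). -/
theorem exists_cosetRep_mul (sq : ∀ k < N, t k * t k = 1)
    (comm : ∀ k l, k + 1 < l → l < N → t k * t l = t l * t k)
    (braid : ∀ k, k + 1 < N → t k * t (k + 1) * t k = t (k + 1) * t k * t (k + 1))
    {m : ℕ} (hm : m < N) {g : H} (hg : g ∈ Submonoid.closure (t '' Set.Iio (m + 1))) :
    ∃ i ≤ m + 1, ∃ g' ∈ Submonoid.closure (t '' Set.Iio m), g = cosetRep t m i * g' := by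
  induction hg using Submonoid.closure_induction_left with
  | one => exact ⟨0, by omega, 1, one_mem _, by simp [cosetRep]⟩
  | mul_left x hx y _ ih =>
    obtain ⟨k, hk, rfl⟩ := hx
    obtain ⟨i, hi, g', hg', rfl⟩ := ih
    have hk : k < m + 1 := hk
    have mem : ∀ j < m, t j ∈ Submonoid.closure (t '' Set.Iio m) :=
      fun j hj => Submonoid.subset_closure ⟨j, hj, rfl⟩
    rcases lt_trichotomy (k + i) m with h | h | h
    · refine ⟨i, hi, t k * g', mul_mem (mem k (by omega)) hg', ?_⟩
      rw [← mul_assoc, mul_cosetRep_of_lt comm hm i k h, mul_assoc]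
    · refine ⟨i + 1, by omega, g', hg', ?_⟩
      rw [cosetRep, mul_assoc, show m - i = k by omega]
    · rcases Nat.lt_or_ge (m + 1) (k + i) with h' | h'
      · refine ⟨i, hi, t (k - 1) * g', mul_mem (mem _ (by omega)) hg', ?_⟩
        rw [← mul_assoc, mul_cosetRep_of_gt comm braid hm i k hi (by omega) h', mul_assoc]
      · obtain ⟨i, rfl⟩ : ∃ j, i = j + 1 := ⟨i - 1, by omega⟩
        refine ⟨i, by omega, g', hg', ?_⟩
        rw [cosetRep, show m - i = k by omega, ← mul_assoc, ← mul_assoc, sq k (by omega), one_mul]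

theorem exists_mem_closure_inverse {S : Set H} (hS : ∀ a ∈ S, a * a = 1) {g : H}
    (hg : g ∈ Submonoid.closure S) : ∃ g' ∈ Submonoid.closure S, g * g' = 1 ∧ g' * g = 1 := by
  induction hg using Submonoid.closure_induction with
  | mem x hx => exact ⟨x, Submonoid.subset_closure hx, hS x hx, hS x hx⟩
  | one => exact ⟨1, one_mem _, by simp, by simp⟩
  | mul x y _ _ hx hy =>
    obtain ⟨x', hx', h1, h2⟩ := hx
    obtain ⟨y', hy', h3, h4⟩ := hy
    refine ⟨y' * x', mul_mem hy' hx', ?_, ?_⟩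
    · rw [mul_assoc, ← mul_assoc y, h3, one_mul, h1]
    · rw [mul_assoc, ← mul_assoc x', h2, one_mul, h4]

/-- The adjacent transposition of the positions `k` and `k + 1`. -/
def adjSwap {n : ℕ} (k : ℕ) (h : k + 1 < n) : Equiv.Perm (Fin n) :=
  Equiv.swap ⟨k, Nat.lt_of_succ_lt h⟩ ⟨k + 1, h⟩

theorem adjSwap_apply_left {n : ℕ} (k : ℕ) (h : k + 1 < n) :
    adjSwap k h ⟨k, Nat.lt_of_succ_lt h⟩ = ⟨k + 1, h⟩ := Equiv.swap_apply_left _ _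

theorem adjSwap_apply_right {n : ℕ} (k : ℕ) (h : k + 1 < n) :
    adjSwap k h ⟨k + 1, h⟩ = ⟨k, Nat.lt_of_succ_lt h⟩ := Equiv.swap_apply_right _ _

theorem adjSwap_apply_of_ne {n : ℕ} (k : ℕ) (h : k + 1 < n) {j : Fin n} (h1 : (j : ℕ) ≠ k)
    (h2 : (j : ℕ) ≠ k + 1) : adjSwap k h j = j :=
  Equiv.swap_apply_of_ne_of_ne (fun e => h1 (by rw [e])) (fun e => h2 (by rw [e]))

theorem adjSwap_mul_self {n : ℕ} (k : ℕ) (h : k + 1 < n) : adjSwap k h * adjSwap k h = 1 :=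
  Equiv.swap_mul_self _ _

theorem closure_adjSwap (n : ℕ) :
    Submonoid.closure {σ : Equiv.Perm (Fin n) | ∃ k h, σ = adjSwap k h} = ⊤ := by
  cases n with
  | zero => exact Subsingleton.elim _ _
  | succ n =>
    rw [eq_top_iff, ← Equiv.Perm.mclosure_swap_castSucc_succ n]
    refine Submonoid.closure_mono ?_
    rintro _ ⟨k, rfl⟩
    exact ⟨k, by omega, rfl⟩

theorem perm_induction_adjSwap {n : ℕ} {P : Equiv.Perm (Fin n) → Prop} (h1 : P 1)
    (hmul : ∀ σ τ, P σ → P τ → P (σ * τ)) (hs : ∀ k h, P (adjSwap k h)) (σ : Equiv.Perm (Fin n)) :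
    P σ := by
  have hσ : σ ∈ Submonoid.closure {σ : Equiv.Perm (Fin n) | ∃ k h, σ = adjSwap k h} := by
    rw [closure_adjSwap]; trivial
  induction hσ using Submonoid.closure_induction with
  | mem σ hσ =>
    obtain ⟨k, h, rfl⟩ := hσ
    exact hs k h
  | one => exact h1
  | mul σ τ _ _ h1 h2 => exact hmul σ τ h1 h2

theorem adjSwap_comm {n : ℕ} (k l : ℕ) (hk : k + 1 < n) (hl : l + 1 < n) (hkl : k + 1 < l) :
    adjSwap k hk * adjSwap l hl = adjSwap l hl * adjSwap k hk := by
  refine (Equiv.Perm.Disjoint.commute ?_).eq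
  intro j
  by_cases h1 : (j : ℕ) ≠ k ∧ (j : ℕ) ≠ k + 1
  · exact Or.inl (adjSwap_apply_of_ne k hk h1.1 h1.2)
  · exact Or.inr (adjSwap_apply_of_ne l hl (by omega) (by omega))

theorem adjSwap_braid {n : ℕ} (k : ℕ) (h : k + 1 < n) (h' : k + 1 + 1 < n) :
    adjSwap k h * adjSwap (k + 1) h' * adjSwap k h
      = adjSwap (k + 1) h' * adjSwap k h * adjSwap (k + 1) h' := by
  have e1 := Equiv.swap_mul_swap_mul_swap (x := (⟨k + 1 + 1, h'⟩ : Fin n)) (y := ⟨k + 1, h⟩)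
    (z := ⟨k, by omega⟩) (by simp) (by simp; omega)
  have e2 := Equiv.swap_mul_swap_mul_swap (x := (⟨k, by omega⟩ : Fin n)) (y := ⟨k + 1, h⟩)
    (z := ⟨k + 1 + 1, h'⟩) (by simp) (by simp; omega)
  rw [Equiv.swap_comm (⟨k + 1, h⟩ : Fin n) ⟨k, by omega⟩,
    Equiv.swap_comm (⟨k + 1 + 1, h'⟩ : Fin n) ⟨k + 1, h⟩] at e1
  exact e1.trans ((Equiv.swap_comm _ _).trans e2.symm)

/-- The symmetric group is presented by the adjacent transpositions and the Coxeter relations. -/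
theorem exists_perm_hom {G : Type*} [Monoid G] (n : ℕ) (t : ∀ k, k + 1 < n → G)
    (sq : ∀ k h, t k h * t k h = 1)
    (comm : ∀ k l hk hl, k + 1 < l → t k hk * t l hl = t l hl * t k hk)
    (braid : ∀ k h h', t k h * t (k + 1) h' * t k h = t (k + 1) h' * t k h * t (k + 1) h') :
    ∃ ρ : Equiv.Perm (Fin n) →* G, ∀ k h, ρ (adjSwap k h) = t k h := by
  -- The homomorphism is found as a graph: the pairs generate a submonoid Γ of the product, and Γ
  -- turns out to project bijectively onto the permutations. The value 1 outside the range never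
  -- enters Γ.
  let u : ℕ → G × Equiv.Perm (Fin n) := fun k => if h : k + 1 < n then (t k h, adjSwap k h) else 1
  have hu : ∀ k (h : k + 1 < n), u k = (t k h, adjSwap k h) := fun k h => dif_pos h
  have usq : ∀ k < n - 1, u k * u k = 1 := fun k hk => by
    rw [hu k (by omega), Prod.mk_mul_mk, sq, adjSwap_mul_self]; rfl
  have ucomm : ∀ k l, k + 1 < l → l < n - 1 → u k * u l = u l * u k := fun k l hkl hl => by
    rw [hu k (by omega), hu l (by omega), Prod.mk_mul_mk, Prod.mk_mul_mk, comm _ _ _ _ hkl,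
      adjSwap_comm _ _ _ _ hkl]
  have ubraid : ∀ k, k + 1 < n - 1 → u k * u (k + 1) * u k = u (k + 1) * u k * u (k + 1) :=
    fun k hk => by
      simp only [hu k (by omega), hu (k + 1) (by omega), Prod.mk_mul_mk, braid, adjSwap_braid]
  have hfix : ∀ m, ∀ g ∈ Submonoid.closure (u '' Set.Iio m), ∀ j : Fin n, m < j → g.2 j = j := by
    intro m g hg j hj
    induction hg using Submonoid.closure_induction with
    | mem x hx =>
      obtain ⟨k, hk, rfl⟩ := hx
      have hk : k < m := hk
      rw [hu k (by omega)]
      exact adjSwap_apply_of_ne _ _ (by omega) (by omega)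
    | one => rfl
    | mul x y _ _ hx hy =>
      rw [Prod.snd_mul, Equiv.Perm.mul_apply, hy, hx]
  have hrep : ∀ m (hm : m + 1 < n) i (hi : i ≤ m + 1),
      (cosetRep u m i).2 ⟨m + 1, hm⟩ = ⟨m + 1 - i, by omega⟩ := by
    intro m hm i hi
    induction i with
    | zero => rfl
    | succ i ih =>
      rw [cosetRep, Prod.snd_mul, Equiv.Perm.mul_apply, ih (by omega), hu (m - i) (by omega)]
      have := adjSwap_apply_right (n := n) (m - i) (by omega)
      convert this using 2
      · simp; omega
      · simp
  -- The image of the point m + 1 reads off the length i of the coset representative, so a trivial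
  -- permutation forces i = 0 and the element lies one level down.
  have hinj : ∀ m, m < n → ∀ g ∈ Submonoid.closure (u '' Set.Iio m), g.2 = 1 → g = 1 := by
    intro m
    induction m with
    | zero => intro _ g hg _; simpa using hg
    | succ m ih =>
      intro hm g hg hg1
      obtain ⟨i, hi, g', hg', rfl⟩ := exists_cosetRep_mul usq ucomm ubraid (by omega) hg
      have h1 : (cosetRep u m i * g').2 ⟨m + 1, hm⟩ = ⟨m + 1, hm⟩ := by rw [hg1]; rfl
      rw [Prod.snd_mul, Equiv.Perm.mul_apply, hfix m g' hg' _ (by simp), hrep m hm i hi] at h1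
      obtain rfl : i = 0 := by simp at h1; omega
      rw [cosetRep, one_mul] at hg1 ⊢
      exact ih (by omega) g' hg' hg1
  set Γ := Submonoid.closure (u '' Set.Iio (n - 1)) with hΓ
  have hsurj : ∀ σ : Equiv.Perm (Fin n), ∃ g ∈ Γ, g.2 = σ := by
    intro σ
    have : σ ∈ Submonoid.closure {σ : Equiv.Perm (Fin n) | ∃ k h, σ = adjSwap k h} := by
      rw [closure_adjSwap]; trivial
    induction this using Submonoid.closure_induction with
    | mem x hx =>
      obtain ⟨k, h, rfl⟩ := hx
      exact ⟨u k, Submonoid.subset_closure ⟨k, by simp; omega, rfl⟩, by rw [hu k h]⟩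
    | one => exact ⟨1, one_mem _, rfl⟩
    | mul x y _ _ hx hy =>
      obtain ⟨a, ha, rfl⟩ := hx
      obtain ⟨b, hb, rfl⟩ := hy
      exact ⟨a * b, mul_mem ha hb, rfl⟩
  have huniq : ∀ a ∈ Γ, ∀ b ∈ Γ, a.2 = b.2 → a = b := by
    intro a ha b hb hab
    rcases Nat.eq_zero_or_pos n with rfl | hn
    · have : u '' Set.Iio (0 - 1) = ∅ := by simp
      rw [hΓ, this] at ha hb
      simp only [Submonoid.closure_empty, Submonoid.mem_bot] at ha hb
      rw [ha, hb]
    obtain ⟨a', ha', h1, h2⟩ := exists_mem_closure_inverse (by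
      rintro _ ⟨k, hk, rfl⟩; exact usq k hk) ha
    have h3 : a' * b = 1 := by
      refine hinj (n - 1) (by omega) _ (mul_mem ha' hb) ?_
      rw [Prod.snd_mul, ← hab, ← Prod.snd_mul, h2]; rfl
    calc a = a * (a' * b) := by rw [h3, mul_one]
      _ = b := by rw [← mul_assoc, h1, one_mul]
  choose f hf hf2 using hsurj
  refine ⟨{ toFun := fun σ => (f σ).1
            map_one' := ?_
            map_mul' := ?_ }, ?_⟩
  · rw [huniq (f 1) (hf 1) 1 (one_mem _) (hf2 1)]; rfl
  · intro σ τ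
    rw [huniq (f (σ * τ)) (hf _) (f σ * f τ) (mul_mem (hf _) (hf _))
      (by rw [hf2, Prod.snd_mul, hf2, hf2]), Prod.fst_mul]
  · intro k h
    change (f (adjSwap k h)).1 = _
    rw [huniq (f (adjSwap k h)) (hf _) (u k)
      (Submonoid.subset_closure ⟨k, by simp; omega, rfl⟩) (by rw [hf2, hu k h]), hu k h]

end CoxeterPresentation

/-! ### Systems of generators and Jucys-Murphy elements -/

section Systems

/-- The first of the two positions exchanged by the `k`-th simple transposition. -/
abbrev lo {n : ℕ} (k : ℕ) (h : k + 1 < n) : Fin n := ⟨k, Nat.lt_of_succ_lt h⟩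

/-- The second of the two positions exchanged by the `k`-th simple transposition. -/
abbrev hi {n : ℕ} (k : ℕ) (h : k + 1 < n) : Fin n := ⟨k + 1, h⟩

/-- Elements of a ring which satisfy the relations of the affine Hecke-Clifford algebra. -/
structure AffineSystem {R : Type*} [Ring R] {n : ℕ} (s : ∀ k, k + 1 < n → R) (x c : Fin n → R) :
    Prop where
  s_sq : ∀ k h, s k h * s k h = 1
  s_comm : ∀ k l hk hl, k + 1 < l → s k hk * s l hl = s l hl * s k hk
  s_braid : ∀ k h h', s k h * s (k + 1) h' * s k h = s (k + 1) h' * s k h * s (k + 1) h'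
  x_comm : ∀ i j, x i * x j = x j * x i
  c_sq : ∀ i, c i * c i = 1
  c_anticomm : ∀ i j, i ≠ j → c i * c j = -(c j * c i)
  s_x : ∀ k h, s k h * x (lo k h) = x (hi k h) * s k h - (1 + c (lo k h) * c (hi k h))
  s_x_far : ∀ k h (j : Fin n), (j : ℕ) ≠ k → (j : ℕ) ≠ k + 1 → s k h * x j = x j * s k h
  s_c : ∀ k h, s k h * c (lo k h) = c (hi k h) * s k h
  s_c_succ : ∀ k h, s k h * c (hi k h) = c (lo k h) * s k h
  s_c_far : ∀ k h (j : Fin n), (j : ℕ) ≠ k → (j : ℕ) ≠ k + 1 → s k h * c j = c j * s k h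
  x_c_same : ∀ i, x i * c i = -(c i * x i)
  x_c_ne : ∀ i j, i ≠ j → x i * c j = c j * x i

variable (F : Type u) [Field F] (n : ℕ)

theorem affineSystem_affineGen :
    AffineSystem (fun k h => affineGen F n (.s k h)) (affineX F n)
      (fun k => affineGen F n (.c k)) := by
  have key := fun a b (h : AffineRel F n a b) => RingQuot.mkAlgHom_rel F h
  constructor
  · intro k h; simpa [affineGen] using key _ _ (.s_sq k h)
  · intro k l hk hl hkl; simpa [affineGen] using key _ _ (.s_comm k l hk hl hkl)
  · intro k h h'; simpa [affineGen] using key _ _ (.s_braid k h h')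
  · intro i j; simpa [affineX, affineGen] using key _ _ (.x_comm i j)
  · intro i; simpa [affineGen] using key _ _ (.c_sq i)
  · intro i j hij; simpa [affineGen] using key _ _ (.c_anticomm i j hij)
  · intro k h; simpa [affineX, affineGen] using key _ _ (.s_x k h)
  · intro k h j h1 h2; simpa [affineX, affineGen] using key _ _ (.s_x_far k h j h1 h2)
  · intro k h; simpa [affineGen] using key _ _ (.s_c k h)
  · intro k h; simpa [affineGen] using key _ _ (.s_c_succ k h)
  · intro k h j h1 h2; simpa [affineGen] using key _ _ (.s_c_far k h j h1 h2)
  · intro i; simpa [affineX, affineGen] using key _ _ (.x_c_same i)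
  · intro i j hij; simpa [affineX, affineGen] using key _ _ (.x_c_ne i j hij)

variable {F n}

theorem AffineSystem.map {R R' : Type*} [Ring R] [Ring R'] {s : ∀ k, k + 1 < n → R}
    {x c : Fin n → R} (h : AffineSystem s x c) (f : R →+* R') :
    AffineSystem (fun k hk => f (s k hk)) (fun k => f (x k)) (fun k => f (c k)) := by
  constructor <;> intros <;> simp only [← map_mul, ← map_neg, ← map_one f, ← map_add, ← map_sub]
  · rw [h.s_sq]
  · rw [h.s_comm]; assumption
  · rw [h.s_braid]
  · rw [h.x_comm]
  · rw [h.c_sq]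
  · rw [h.c_anticomm]; assumption
  · rw [h.s_x]
  · rw [h.s_x_far] <;> assumption
  · rw [h.s_c]
  · rw [h.s_c_succ]
  · rw [h.s_c_far] <;> assumption
  · rw [h.x_c_same]
  · rw [h.x_c_ne]; assumption

theorem AffineSystem.rankOne {R : Type*} [Ring R] {s : ∀ k, k + 1 < n → R}
    {x c : Fin n → R} (h : AffineSystem s x c) (k : ℕ) (hk : k + 1 < n) :
    RankOneSystem (s k hk) (x (lo k hk)) (x (hi k hk)) (c (lo k hk)) (c (hi k hk)) := by
  have ne : lo k hk ≠ hi k hk := by simp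
  exact ⟨h.s_sq _ _, h.s_x _ _, h.s_c _ _, h.s_c_succ _ _, h.x_comm _ _, h.x_c_same _,
    h.x_c_same _, h.x_c_ne _ _ ne, h.x_c_ne _ _ ne.symm, h.c_sq _, h.c_sq _,
    h.c_anticomm _ _ ne.symm⟩

/-- The family of images of the generators given by an `AffineSystem`. -/
def affineImage {R : Type*} (s : ∀ k, k + 1 < n → R) (x c : Fin n → R) : AffineGen n → R
  | .s k h => s k h
  | .x k => x k
  | .c k => c k

theorem AffineSystem.exists_hom {R : Type*} [Ring R] [Algebra F R] {s : ∀ k, k + 1 < n → R}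
    {x c : Fin n → R} (h : AffineSystem s x c) :
    ∃ f : AffineHeckeClifford F n →ₐ[F] R, ∀ g, f (affineGen F n g) = affineImage s x c g := by
  refine ⟨RingQuot.liftAlgHom F ⟨FreeAlgebra.lift F (affineImage s x c), ?_⟩, ?_⟩
  · intro a b hab
    induction hab <;> simp [affineImage]
    · apply h.s_sq
    · apply h.s_comm; assumption
    · apply h.s_braid
    · apply h.x_comm
    · apply h.c_sq
    · apply h.c_anticomm; assumption
    · apply h.s_x
    · apply h.s_x_far <;> assumption
    · apply h.s_c
    · apply h.s_c_succ
    · apply h.s_c_far <;> assumption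
    · apply h.x_c_same
    · apply h.x_c_ne; assumption
  · intro g
    simp [affineGen]

/-- A representation of the symmetric group together with elements `c` which satisfy the relations
of the finite Hecke-Clifford algebra. -/
structure FiniteSystem {R : Type*} [Ring R] (w : Equiv.Perm (Fin n) →* R) (c : Fin n → R) :
    Prop where
  c_sq : ∀ i, c i * c i = 1
  c_anticomm : ∀ i j, i ≠ j → c i * c j = -(c j * c i)
  w_c : ∀ σ i, w σ * c i = c (σ i) * w σ

/-- The family of images of the generators given by a `FiniteSystem`. -/
def finiteImage {R : Type*} [Ring R] (w : Equiv.Perm (Fin n) →* R) (c : Fin n → R) :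
    FiniteGen n → R
  | .c k => c k
  | .w σ => w σ

variable (F n) in
/-- The group elements of the finite Hecke-Clifford algebra. -/
def finiteW : Equiv.Perm (Fin n) →* FiniteHeckeClifford F n where
  toFun σ := finiteGen F n (.w σ)
  map_one' := by simpa [finiteGen] using RingQuot.mkAlgHom_rel F (FiniteRel.w_one (F := F) (n := n))
  map_mul' σ τ := by
    simpa [finiteGen] using RingQuot.mkAlgHom_rel F (FiniteRel.w_mul (F := F) (n := n) σ τ)

variable (F n) in
/-- The Clifford generators of the finite Hecke-Clifford algebra. -/
def finiteC (k : Fin n) : FiniteHeckeClifford F n := finiteGen F n (.c k)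

variable (F n) in
theorem finiteSystem_finiteGen : FiniteSystem (finiteW F n) (finiteC F n) := by
  have key := fun a b (h : FiniteRel F n a b) => RingQuot.mkAlgHom_rel F h
  constructor
  · intro i; simpa [finiteC, finiteGen] using key _ _ (.c_sq i)
  · intro i j hij; simpa [finiteC, finiteGen] using key _ _ (.c_anticomm i j hij)
  · intro σ i; simpa [finiteC, finiteW, finiteGen] using key _ _ (.w_c σ i)

theorem FiniteSystem.exists_hom {R : Type*} [Ring R] [Algebra F R] {w : Equiv.Perm (Fin n) →* R}
    {c : Fin n → R} (h : FiniteSystem w c) :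
    ∃ f : FiniteHeckeClifford F n →ₐ[F] R, ∀ g, f (finiteGen F n g) = finiteImage w c g := by
  refine ⟨RingQuot.liftAlgHom F ⟨FreeAlgebra.lift F (finiteImage w c), ?_⟩, ?_⟩
  · intro a b hab
    induction hab <;> simp [finiteImage]
    · apply h.c_sq
    · apply h.c_anticomm; assumption
    · apply h.w_c
  · intro g
    simp [finiteGen]

/-- The summands of the Jucys-Murphy elements. -/
def jmTerm {R : Type*} [Ring R] (w : Equiv.Perm (Fin n) →* R) (c : Fin n → R) (j k : Fin n) : R :=
  (1 + c j * c k) * w (Equiv.swap j k)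

namespace FiniteSystem

variable {R : Type*} [Ring R] {w : Equiv.Perm (Fin n) →* R} {c : Fin n → R}
  (h : FiniteSystem w c)
include h

theorem c_mul_c_mul {i j : Fin n} (hij : i ≠ j) (t : R) : c i * (c j * t) = -(c j * (c i * t)) := by
  rw [← mul_assoc, h.c_anticomm i j hij, neg_mul, mul_assoc]

theorem c_mul_self_mul (i : Fin n) (t : R) : c i * (c i * t) = t := by
  rw [← mul_assoc, h.c_sq, one_mul]

theorem c_mul_w (σ : Equiv.Perm (Fin n)) (i : Fin n) : c i * w σ = w σ * c (σ⁻¹ i) := by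
  rw [h.w_c, ← Equiv.Perm.mul_apply, mul_inv_cancel, Equiv.Perm.one_apply]

theorem w_jmTerm (σ : Equiv.Perm (Fin n)) (j k : Fin n) :
    w σ * jmTerm w c j k = jmTerm w c (σ j) (σ k) * w σ := by
  have e : w σ * (1 + c j * c k) = (1 + c (σ j) * c (σ k)) * w σ := by
    rw [mul_add, add_mul, ← mul_assoc, h.w_c, mul_assoc, h.w_c]
    noncomm_ring
  rw [jmTerm, jmTerm, ← mul_assoc, e, mul_assoc, mul_assoc, ← map_mul, ← map_mul,
    Equiv.mul_swap_eq_swap_mul]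

theorem jmTerm_c_of_ne {j k l : Fin n} (hj : l ≠ j) (hk : l ≠ k) :
    jmTerm w c j k * c l = c l * jmTerm w c j k := by
  have e : (1 + c j * c k) * c l = c l * (1 + c j * c k) := by
    rw [mul_add, add_mul, ← mul_assoc, mul_assoc, h.c_anticomm k l hk.symm, mul_neg, ← mul_assoc,
      h.c_anticomm j l hj.symm]
    noncomm_ring
  rw [jmTerm, mul_assoc, h.w_c, Equiv.swap_apply_of_ne_of_ne hj hk, ← mul_assoc, e, mul_assoc]

/-- The transposition turns c j into c k, and both (1 + c j c k) c k and c j (1 + c j c k) equal c j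
+ c k. -/
theorem jmTerm_c_left (j k : Fin n) :
    jmTerm w c j k * c j = c j * jmTerm w c j k := by
  have e : (1 + c j * c k) * c k = c j * (1 + c j * c k) := by
    rw [mul_add, add_mul, ← mul_assoc, mul_assoc, h.c_sq, h.c_sq]
    noncomm_ring
  rw [jmTerm, mul_assoc, h.w_c, Equiv.swap_apply_left, ← mul_assoc, e, mul_assoc]

theorem jmTerm_c_right {j k : Fin n} (hjk : j ≠ k) :
    jmTerm w c j k * c k = -(c k * jmTerm w c j k) := by
  have e : (1 + c j * c k) * c j = -(c k * (1 + c j * c k)) := by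
    rw [h.c_anticomm j k hjk, mul_add, mul_neg, ← mul_assoc, h.c_sq, add_mul, neg_mul, mul_assoc,
      h.c_sq]
    noncomm_ring
  rw [jmTerm, mul_assoc, h.w_c, Equiv.swap_apply_right, ← mul_assoc, e, neg_mul, mul_assoc]

end FiniteSystem

theorem jucysMurphy_eq (k : Fin n) : jucysMurphy F n k
    = ∑ j ∈ Finset.univ.filter (fun j : Fin n => j < k), jmTerm (finiteW F n) (finiteC F n) j k :=
  rfl

/-- The hypothesis says that σ carries the summation range of one Jucys-Murphy element onto that of
the other; conjugation by σ then only permutes the summands. -/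
theorem finiteW_jucysMurphy (σ : Equiv.Perm (Fin n)) (k : Fin n)
    (hσ : ∀ j, j < k ↔ σ j < σ k) :
    finiteW F n σ * jucysMurphy F n k = jucysMurphy F n (σ k) * finiteW F n σ := by
  rw [jucysMurphy_eq, jucysMurphy_eq, Finset.mul_sum, Finset.sum_mul]
  refine Finset.sum_equiv σ (by simpa using hσ) fun j _ => ?_
  exact (finiteSystem_finiteGen F n).w_jmTerm σ j k

theorem jucysMurphy_c_of_ne {k l : Fin n} (hkl : k ≠ l) :
    jucysMurphy F n k * finiteC F n l = finiteC F n l * jucysMurphy F n k := by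
  rw [jucysMurphy_eq, Finset.mul_sum, Finset.sum_mul]
  refine Finset.sum_congr rfl fun j hj => ?_
  have hj : j < k := by simpa using hj
  by_cases hjl : l = j
  · subst hjl; exact (finiteSystem_finiteGen F n).jmTerm_c_left _ _
  · exact (finiteSystem_finiteGen F n).jmTerm_c_of_ne hjl hkl.symm

theorem jucysMurphy_c_self (k : Fin n) :
    jucysMurphy F n k * finiteC F n k = -(finiteC F n k * jucysMurphy F n k) := by
  rw [jucysMurphy_eq, Finset.mul_sum, Finset.sum_mul, ← Finset.sum_neg_distrib]
  refine Finset.sum_congr rfl fun j hj => ?_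
  have hj : j < k := by simpa using hj
  exact (finiteSystem_finiteGen F n).jmTerm_c_right hj.ne

/-- The later element commutes with the Clifford generators and transpositions of all positions
below j, and the earlier one is built from these. -/
theorem jucysMurphy_commute_of_lt {i j : Fin n} (hij : i < j) :
    Commute (jucysMurphy F n j) (jucysMurphy F n i) := by
  have hc : ∀ a < j, Commute (jucysMurphy F n j) (finiteC F n a) :=
    fun a ha => jucysMurphy_c_of_ne ha.ne'
  conv => arg 2; rw [jucysMurphy_eq]
  refine Commute.sum_right _ _ _ fun a ha => ?_
  have ha : a < i := by simpa using ha
  refine Commute.mul_right (((Commute.one_right _).add_right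
    ((hc a (ha.trans hij)).mul_right (hc i hij)))) ?_
  have e := finiteW_jucysMurphy (F := F) (Equiv.swap a i) j ?_
  · rw [Equiv.swap_apply_of_ne_of_ne (ha.trans hij).ne' hij.ne'] at e
    exact e.symm
  · intro l
    rw [Equiv.swap_apply_of_ne_of_ne (ha.trans hij).ne' hij.ne']
    by_cases h1 : l = a
    · subst h1; simp [ha.trans hij, hij]
    · by_cases h2 : l = i
      · subst h2; simp [ha.trans hij, hij]
      · rw [Equiv.swap_apply_of_ne_of_ne h1 h2]

/-- The later Jucys-Murphy element has one summand more; multiplied by the simple transposition this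
summand becomes 1 + c c, the error term of the affine relation. -/
theorem finiteW_jucysMurphy_lo (k : ℕ) (h : k + 1 < n) :
    finiteW F n (adjSwap k h) * jucysMurphy F n (lo k h)
      = jucysMurphy F n (hi k h) * finiteW F n (adjSwap k h)
        - (1 + finiteC F n (lo k h) * finiteC F n (hi k h)) := by
  have hf : Finset.univ.filter (fun j : Fin n => j < hi k h)
      = insert (lo k h) (Finset.univ.filter (fun j : Fin n => j < lo k h)) := by
    ext j
    simp [Fin.lt_def, Fin.ext_iff]
    omega
  have e1 : jmTerm (finiteW F n) (finiteC F n) (lo k h) (hi k h) * finiteW F n (adjSwap k h)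
      = 1 + finiteC F n (lo k h) * finiteC F n (hi k h) := by
    rw [jmTerm, mul_assoc, ← map_mul]
    have : Equiv.swap (lo k h) (hi k h) * adjSwap k h = 1 := adjSwap_mul_self k h
    rw [this, map_one, mul_one]
  rw [jucysMurphy_eq, jucysMurphy_eq, hf, Finset.sum_insert (by simp), add_mul, e1,
    add_sub_cancel_left, Finset.mul_sum, Finset.sum_mul]
  refine Finset.sum_congr rfl fun j hj => ?_
  have hj : j < lo k h := by simpa using hj
  have hj' : (j : ℕ) < k := hj
  rw [(finiteSystem_finiteGen F n).w_jmTerm, adjSwap_apply_left,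
    adjSwap_apply_of_ne _ _ (by omega) (by omega)]

variable (F n) in
/-- The Jucys-Murphy elements satisfy the relations of the polynomial generators of the affine
Hecke-Clifford algebra. -/
theorem affineSystem_jucysMurphy :
    AffineSystem (fun k h => finiteW F n (adjSwap k h)) (jucysMurphy F n) (finiteC F n) where
  s_sq k h := by rw [← map_mul, adjSwap_mul_self, map_one]
  s_comm k l hk hl hkl := by rw [← map_mul, adjSwap_comm k l hk hl hkl, map_mul]
  s_braid k h h' := by simp only [← map_mul, adjSwap_braid]
  x_comm i j := by
    rcases lt_trichotomy i j with h | rfl | h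
    · exact (jucysMurphy_commute_of_lt h).symm.eq
    · rfl
    · exact (jucysMurphy_commute_of_lt h).eq
  c_sq := (finiteSystem_finiteGen F n).c_sq
  c_anticomm := (finiteSystem_finiteGen F n).c_anticomm
  s_x := finiteW_jucysMurphy_lo
  s_x_far k h j h1 h2 := by
    have e := finiteW_jucysMurphy (F := F) (adjSwap k h) j ?_
    · rwa [adjSwap_apply_of_ne _ _ h1 h2] at e
    · intro l
      rw [adjSwap_apply_of_ne _ _ h1 h2]
      by_cases hl : (l : ℕ) = k
      · obtain rfl : l = lo k h := Fin.ext hl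
        rw [adjSwap_apply_left, Fin.lt_def, Fin.lt_def]
        simp; omega
      · by_cases hl2 : (l : ℕ) = k + 1
        · obtain rfl : l = hi k h := Fin.ext hl2
          rw [adjSwap_apply_right, Fin.lt_def, Fin.lt_def]
          simp; omega
        · rw [adjSwap_apply_of_ne _ _ hl hl2]
  s_c k h := by rw [(finiteSystem_finiteGen F n).w_c, adjSwap_apply_left]
  s_c_succ k h := by rw [(finiteSystem_finiteGen F n).w_c, adjSwap_apply_right]
  s_c_far k h j h1 h2 := by
    rw [(finiteSystem_finiteGen F n).w_c, adjSwap_apply_of_ne _ _ h1 h2]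
  x_c_same := jucysMurphy_c_self
  x_c_ne i j hij := jucysMurphy_c_of_ne hij

theorem jucysMurphy_zero (k : Fin n) (hk : (k : ℕ) = 0) : jucysMurphy F n k = 0 := by
  rw [jucysMurphy_eq, Finset.filter_false_of_mem, Finset.sum_empty]
  intro j _ hj
  rw [Fin.lt_def] at hj
  omega

end Systems

/-! ### Simultaneous eigenspaces of the squares -/

section WeightSpaces

namespace AffineSystem

variable {R : Type*} [Ring R] {n : ℕ} {s : ∀ k, k + 1 < n → R} {x c : Fin n → R}

/-- The crossing element at the positions `k` and `k + 1`. -/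
def cross (x c : Fin n → R) (k : ℕ) (h : k + 1 < n) : R :=
  crossing (x (lo k h)) (x (hi k h)) (c (lo k h)) (c (hi k h))

/-- The intertwining element at the positions `k` and `k + 1`. -/
def inter (s : ∀ k, k + 1 < n → R) (x c : Fin n → R) (k : ℕ) (h : k + 1 < n) : R :=
  twine (s k h) (x (lo k h)) (x (hi k h)) (c (lo k h)) (c (hi k h))

theorem commute_crossing {a x y c d : R} (hx : Commute a x) (hy : Commute a y)
    (hcd : Commute a (c * d)) : Commute a (crossing x y c d) :=
  (hx.add_right hy).add_right (hcd.mul_right (hx.sub_right hy))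

theorem commute_twine {a s x y c d : R} (hs : Commute a s) (hx : Commute a x) (hy : Commute a y)
    (hcd : Commute a (c * d)) : Commute a (twine s x y c d) :=
  (hs.mul_right ((hy.mul_right hy).sub_right (hx.mul_right hx))).sub_right
    (commute_crossing hx hy hcd)

variable (A : AffineSystem s x c)
include A

theorem commute_x_c_mul_c (k : ℕ) (h : k + 1 < n) (j : Fin n) (h1 : (j : ℕ) ≠ k)
    (h2 : (j : ℕ) ≠ k + 1) : Commute (x j) (c (lo k h) * c (hi k h)) :=
  Commute.mul_right (A.x_c_ne j (lo k h) fun e => h1 (by rw [e]))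
    (A.x_c_ne j (hi k h) fun e => h2 (by rw [e]))

theorem commute_c_c_mul_c (k : ℕ) (h : k + 1 < n) (j : Fin n) (h1 : (j : ℕ) ≠ k)
    (h2 : (j : ℕ) ≠ k + 1) : Commute (c j) (c (lo k h) * c (hi k h)) := by
  have hc := A.c_anticomm j (lo k h) fun e => h1 (by rw [e])
  have hd := A.c_anticomm j (hi k h) fun e => h2 (by rw [e])
  rw [Commute, SemiconjBy, ← mul_assoc, hc, neg_mul, mul_assoc, hd, mul_neg, neg_neg, mul_assoc]

theorem x_cross_far (k : ℕ) (h : k + 1 < n) (j : Fin n) (h1 : (j : ℕ) ≠ k)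
    (h2 : (j : ℕ) ≠ k + 1) : Commute (x j) (cross x c k h) :=
  commute_crossing (A.x_comm _ _) (A.x_comm _ _) (A.commute_x_c_mul_c k h j h1 h2)

theorem x_inter_far (k : ℕ) (h : k + 1 < n) (j : Fin n) (h1 : (j : ℕ) ≠ k)
    (h2 : (j : ℕ) ≠ k + 1) : Commute (x j) (inter s x c k h) :=
  commute_twine (A.s_x_far _ _ _ h1 h2).symm (A.x_comm _ _) (A.x_comm _ _)
    (A.commute_x_c_mul_c k h j h1 h2)

theorem c_cross_far (k : ℕ) (h : k + 1 < n) (j : Fin n) (h1 : (j : ℕ) ≠ k)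
    (h2 : (j : ℕ) ≠ k + 1) : Commute (c j) (cross x c k h) :=
  commute_crossing (A.x_c_ne (lo k h) j fun e => h1 (by rw [← e])).symm
    (A.x_c_ne (hi k h) j fun e => h2 (by rw [← e])).symm (A.commute_c_c_mul_c k h j h1 h2)

theorem c_inter_far (k : ℕ) (h : k + 1 < n) (j : Fin n) (h1 : (j : ℕ) ≠ k)
    (h2 : (j : ℕ) ≠ k + 1) : Commute (c j) (inter s x c k h) :=
  commute_twine (A.s_c_far _ _ _ h1 h2).symm (A.x_c_ne (lo k h) j fun e => h1 (by rw [← e])).symm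
    (A.x_c_ne (hi k h) j fun e => h2 (by rw [← e])).symm (A.commute_c_c_mul_c k h j h1 h2)

theorem x_sq_c (i j : Fin n) : Commute (x i * x i) (c j) := by
  by_cases hij : i = j
  · subst hij
    rw [Commute, SemiconjBy, mul_assoc, A.x_c_same, mul_neg, ← mul_assoc, A.x_c_same, neg_mul,
      neg_neg, mul_assoc]
  · have : Commute (x i) (c j) := A.x_c_ne i j hij
    exact this.mul_left this

theorem x_sq_x (i j : Fin n) : Commute (x i * x i) (x j) := by
  have : Commute (x i) (x j) := A.x_comm i j
  exact this.mul_left this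

theorem x_sq_cross (i : Fin n) (k : ℕ) (h : k + 1 < n) : Commute (x i * x i) (cross x c k h) :=
  commute_crossing (A.x_sq_x _ _) (A.x_sq_x _ _) ((A.x_sq_c _ _).mul_right (A.x_sq_c _ _))

theorem inter_x_sq (i : Fin n) (k : ℕ) (h : k + 1 < n) :
    x i * x i * inter s x c k h = inter s x c k h * (x (adjSwap k h i) * x (adjSwap k h i)) := by
  by_cases h1 : (i : ℕ) = k
  · obtain rfl : i = lo k h := Fin.ext h1
    rw [adjSwap_apply_left]
    exact ((A.rankOne k h).twine_y_sq).symm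
  · by_cases h2 : (i : ℕ) = k + 1
    · obtain rfl : i = hi k h := Fin.ext h2
      rw [adjSwap_apply_right]
      exact ((A.rankOne k h).twine_x_sq).symm
    · rw [adjSwap_apply_of_ne k h h1 h2]
      have := A.x_inter_far k h i h1 h2
      exact (this.mul_left this).eq

end AffineSystem

variable {F : Type*} [Field F] {M : Type*} [AddCommGroup M] [Module F M] {n : ℕ}

/-- The simultaneous eigenspace of the squares of the endomorphisms `x k`. -/
def sqEigenspace (x : Fin n → Module.End F M) (χ : Fin n → F) : Submodule F M :=
  ⨅ k, (x k ^ 2).eigenspace (χ k)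

theorem mem_sqEigenspace {x : Fin n → Module.End F M} {χ : Fin n → F} {v : M} :
    v ∈ sqEigenspace x χ ↔ ∀ k, x k (x k v) = χ k • v := by
  simp [sqEigenspace, pow_two]

section

variable {f : Module.End F M} (hf : f.IsSemisimple)
include hf

theorem apply_eq_zero_of_apply_apply_eq_zero {v : M} (h : f (f v) = 0) : f v = 0 := by
  have h1 : v ∈ f.maxGenEigenspace 0 := by
    rw [Module.End.mem_maxGenEigenspace]
    exact ⟨2, by simpa [pow_two] using h⟩
  rw [hf.isFinitelySemisimple.maxGenEigenspace_eq_eigenspace] at h1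
  simpa using h1

/-- A nonzero v would give a Jordan chain of length two for f², which is semisimple because f is. -/
theorem eq_zero_of_sq_eigen [FiniteDimensional F M] [PerfectField F] {μ : F} {u v : M}
    (h : f (f u) = μ • u + v) (hv : f (f v) = μ • v) : v = 0 := by
  have h1 : u ∈ (f ^ 2).maxGenEigenspace μ := by
    rw [Module.End.mem_maxGenEigenspace]
    exact ⟨2, by simp [pow_two, h, hv]⟩
  rw [(hf.pow 2).isFinitelySemisimple.maxGenEigenspace_eq_eigenspace] at h1
  simpa [pow_two, h] using h1

end

section Decomposition

variable [FiniteDimensional F M] {x : Fin n → Module.End F M} (hx : ∀ k, (x k).IsSemisimple)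
include hx

theorem sqEigenspace_eq_iInf_maxGenEigenspace (χ : Fin n → F) :
    sqEigenspace x χ = ⨅ k, (x k ^ 2).maxGenEigenspace (χ k) := by
  simp only [sqEigenspace,
    ((hx _).pow 2).isFinitelySemisimple.maxGenEigenspace_eq_eigenspace]

variable (hc : ∀ i j, x i * x j = x j * x i)
include hc

theorem iSupIndep_sqEigenspace : iSupIndep (sqEigenspace x) := by
  have := Module.End.independent_iInf_maxGenEigenspace_of_forall_mapsTo (fun k => x k ^ 2)
    fun i j φ => Module.End.mapsTo_maxGenEigenspace_of_comm
      (((show Commute (x j) (x i) from hc j i).pow_left 2).pow_right 2) φ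
  simpa only [← sqEigenspace_eq_iInf_maxGenEigenspace hx] using this

theorem iSup_sqEigenspace [IsAlgClosed F] : ⨆ χ, sqEigenspace x χ = ⊤ := by
  have := Module.End.iSup_iInf_maxGenEigenspace_eq_top_of_forall_mapsTo (fun k => x k ^ 2)
    (fun i j φ => Module.End.mapsTo_maxGenEigenspace_of_comm
      (((show Commute (x j) (x i) from hc j i).pow_left 2).pow_right 2) φ)
    fun i => Module.End.iSup_maxGenEigenspace_eq_top _
  simpa only [← sqEigenspace_eq_iInf_maxGenEigenspace hx] using this

/-- An endomorphism may be prescribed on each of the simultaneous eigenspaces. -/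
theorem exists_end_eqOn_sqEigenspace [IsAlgClosed F] (T : (Fin n → F) → Module.End F M) :
    ∃ f : Module.End F M, ∀ χ, ∀ v ∈ sqEigenspace x χ, f v = T χ v := by
  classical
  have hI : DirectSum.IsInternal (sqEigenspace x) :=
    DirectSum.isInternal_submodule_of_iSupIndep_of_iSup_eq_top (iSupIndep_sqEigenspace hx hc)
      (iSup_sqEigenspace hx hc)
  let e := LinearEquiv.ofBijective (DirectSum.coeLinearMap (sqEigenspace x)) hI
  refine ⟨(DirectSum.toModule F _ M fun χ => (T χ).comp (sqEigenspace x χ).subtype).comp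
    e.symm.toLinearMap, fun χ v hv => ?_⟩
  have : e.symm v = DirectSum.lof F _ (fun χ => sqEigenspace x χ) χ ⟨v, hv⟩ := by
    rw [LinearEquiv.symm_apply_eq]
    exact (DirectSum.coeLinearMap_lof (sqEigenspace x) χ ⟨v, hv⟩).symm
  simp [this]

theorem end_ext_sqEigenspace [IsAlgClosed F] {f g : Module.End F M}
    (h : ∀ χ, ∀ v ∈ sqEigenspace x χ, f v = g v) : f = g := by
  ext v
  have hv : v ∈ ⨆ χ, sqEigenspace x χ := by rw [iSup_sqEigenspace hx hc]; trivial
  induction hv using Submodule.iSup_induction' with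
  | mem χ v hv => exact h χ v hv
  | zero => simp
  | add v w _ _ h1 h2 => rw [map_add, map_add, h1, h2]

theorem eq_zero_of_sum_eq_zero {ι : Type*} [Fintype ι] {χ : ι → Fin n → F}
    (hχ : Function.Injective χ) {v : ι → M} (hv : ∀ i, v i ∈ sqEigenspace x (χ i))
    (h0 : ∑ i, v i = 0) (i : ι) : v i = 0 := by
  classical
  have := (iSupIndep_sqEigenspace hx hc).comp hχ
  rw [iSupIndep_iff_finsetSum_eq_zero_imp_eq_zero] at this
  exact this Finset.univ v (fun i _ => hv i) h0 i (Finset.mem_univ i)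

end Decomposition

namespace AffineSystem

variable {s : ∀ k, k + 1 < n → Module.End F M} {x c : Fin n → Module.End F M}

theorem mem_of_commute {a : Module.End F M} (ha : ∀ k, Commute (x k * x k) a) {χ : Fin n → F}
    {v : M} (hv : v ∈ sqEigenspace x χ) : a v ∈ sqEigenspace x χ := by
  rw [mem_sqEigenspace] at hv ⊢
  intro k
  have := LinearMap.congr_fun (ha k).eq v
  simp only [Module.End.mul_apply] at this
  rw [this, hv, map_smul]

theorem inter_apply {χ : Fin n → F} {v : M} (hv : v ∈ sqEigenspace x χ) (k : ℕ) (h : k + 1 < n) :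
    inter s x c k h v = (χ (hi k h) - χ (lo k h)) • s k h v - cross x c k h v := by
  rw [mem_sqEigenspace] at hv
  simp [inter, twine, cross, hv, sub_smul]

variable (A : AffineSystem s x c)
include A

theorem x_mem {χ : Fin n → F} {v : M} (hv : v ∈ sqEigenspace x χ) (k : Fin n) :
    x k v ∈ sqEigenspace x χ := mem_of_commute (fun _ => A.x_sq_x _ _) hv

theorem c_mem {χ : Fin n → F} {v : M} (hv : v ∈ sqEigenspace x χ) (k : Fin n) :
    c k v ∈ sqEigenspace x χ := mem_of_commute (fun _ => A.x_sq_c _ _) hv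

theorem cross_mem {χ : Fin n → F} {v : M} (hv : v ∈ sqEigenspace x χ) (k : ℕ) (h : k + 1 < n) :
    cross x c k h v ∈ sqEigenspace x χ := mem_of_commute (fun _ => A.x_sq_cross _ _ _) hv

theorem inter_mem {χ : Fin n → F} {v : M} (hv : v ∈ sqEigenspace x χ) (k : ℕ) (h : k + 1 < n) :
    inter s x c k h v ∈ sqEigenspace x (χ ∘ adjSwap k h) := by
  rw [mem_sqEigenspace] at hv ⊢
  intro i
  have := LinearMap.congr_fun (A.inter_x_sq i k h) v
  simp only [Module.End.mul_apply] at this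
  rw [this, hv, map_smul, Function.comp_apply]

theorem cross_cross_apply {χ : Fin n → F} {v : M} (hv : v ∈ sqEigenspace x χ) (k : ℕ)
    (h : k + 1 < n) :
    cross x c k h (cross x c k h v) = (2 * (χ (lo k h) + χ (hi k h))) • v := by
  rw [mem_sqEigenspace] at hv
  have := LinearMap.congr_fun (A.rankOne k h).crossing_sq v
  simp only [two_mul, Module.End.mul_apply, LinearMap.add_apply, hv] at this
  rw [cross, this, two_mul, add_smul, add_smul]

theorem inter_inter_apply {χ : Fin n → F} {v : M} (hv : v ∈ sqEigenspace x χ) (k : ℕ)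
    (h : k + 1 < n) :
    inter s x c k h (inter s x c k h v)
      = (2 * (χ (lo k h) + χ (hi k h)) - (χ (hi k h) - χ (lo k h)) ^ 2) • v := by
  rw [mem_sqEigenspace] at hv
  have := LinearMap.congr_fun (A.rankOne k h).twine_sq v
  simp only [two_mul, Module.End.mul_apply, LinearMap.add_apply, LinearMap.sub_apply, hv, map_smul,
    map_sub] at this
  rw [inter, this]
  module

variable [IsAlgClosed F] [FiniteDimensional F M] (hx : ∀ k, (x k).IsSemisimple) (h2 : (2 : F) ≠ 0)
include hx h2

/-- Neighbouring eigenvalues on a completely splittable module are distinct. -/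
theorem lo_ne_hi {χ : Fin n → F} {v : M} (hv : v ∈ sqEigenspace x χ) (hv0 : v ≠ 0) (k : ℕ)
    (h : k + 1 < n) : χ (lo k h) ≠ χ (hi k h) := by
  intro e
  have hm := mem_sqEigenspace.1 hv
  have RS := A.rankOne k h
  -- If the two values agree, s v and the crossing of v form a Jordan chain for the second square,
  -- so the crossing kills v; its own square then makes the common value 0.
  have h1 : x (hi k h) (x (hi k h) (s k h v))
      = χ (lo k h) • s k h v + cross x c k h v := by
    have := LinearMap.congr_fun RS.s_x_sq v
    simp only [Module.End.mul_apply, LinearMap.sub_apply, hm, map_smul] at this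
    rw [cross, this]; abel
  have h3 := mem_sqEigenspace.1 (A.cross_mem hv k h)
  have h4 := eq_zero_of_sq_eigen (hx _) h1 (by rw [h3, e])
  have h5 := A.cross_cross_apply hv k h
  rw [h4, map_zero, ← e, ← two_mul, eq_comm, smul_eq_zero] at h5
  have h6 : χ (lo k h) = 0 := by
    rcases h5 with h5 | h5
    · simpa [h2] using h5
    · exact absurd h5 hv0
  -- Now both x's kill v and the second one kills s v, so the relation for s x leaves (1 + cd) v =
  -- 0. As (cd)² = -1, applying cd and subtracting gives 2v = 0.
  have hlo : x (lo k h) v = 0 :=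
    apply_eq_zero_of_apply_apply_eq_zero (hx _) (by rw [hm, h6, zero_smul])
  have hhi : x (hi k h) v = 0 :=
    apply_eq_zero_of_apply_apply_eq_zero (hx _) (by rw [hm, ← e, h6, zero_smul])
  have h7 := apply_eq_zero_of_apply_apply_eq_zero (hx (hi k h)) (v := s k h v) (by
    rw [h1, h4, h6, zero_smul, zero_add])
  have h8 := LinearMap.congr_fun RS.s_x v
  simp only [Module.End.mul_apply, LinearMap.sub_apply, hlo, map_zero, h7, LinearMap.add_apply,
    Module.End.one_apply, zero_sub] at h8
  have h9 : v + c (lo k h) (c (hi k h) v) = 0 := neg_eq_zero.1 h8.symm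
  have h10 : c (lo k h) (c (hi k h) (v + c (lo k h) (c (hi k h) v))) = 0 := by simp [h9]
  have h11 := LinearMap.congr_fun RS.d_c (c (hi k h) v)
  have h12 := fun u => LinearMap.congr_fun RS.c_c u
  have h13 := fun u => LinearMap.congr_fun RS.d_d u
  simp only [Module.End.mul_apply, LinearMap.neg_apply, Module.End.one_apply] at h11 h12 h13
  rw [map_add, map_add, h11, h13, map_neg, h12] at h10
  have h14 : (2 : F) • v = 0 := by
    rw [two_smul]
    calc v + v = (v + c (lo k h) (c (hi k h) v)) - (c (lo k h) (c (hi k h) v) + -v) := by abel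
      _ = 0 := by rw [h9, h10, sub_zero]
  exact hv0 ((smul_eq_zero.1 h14).resolve_left h2)

end AffineSystem

end WeightSpaces

/-! ### The twisted simple transpositions -/

section Twist

open Classical in
/-- The factor by which the intertwining part of a simple transposition is multiplied in the
twisted action: `0` if the two eigenvalues are linked, `1` otherwise. -/
noncomputable def linkFactor {F : Type*} [Field F] (a b : F) : F :=
  if (a - b) ^ 2 = 2 * (a + b) then 0 else 1

section

variable {F : Type*} [Field F]

theorem linkFactor_comm (a b : F) : linkFactor a b = linkFactor b a := by
  have : (a - b) ^ 2 = 2 * (a + b) ↔ (b - a) ^ 2 = 2 * (b + a) := by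
    rw [show (a - b) ^ 2 = (b - a) ^ 2 by ring, add_comm a b]
  by_cases h : (a - b) ^ 2 = 2 * (a + b)
  · rw [linkFactor, linkFactor, if_pos h, if_pos (this.1 h)]
  · rw [linkFactor, linkFactor, if_neg h, if_neg (mt this.2 h)]

theorem linkFactor_of_eq {a b : F} (h : (a - b) ^ 2 = 2 * (a + b)) : linkFactor a b = 0 :=
  if_pos h

theorem linkFactor_of_ne {a b : F} (h : (a - b) ^ 2 ≠ 2 * (a + b)) : linkFactor a b = 1 :=
  if_neg h

end

/-- The six arrangements of three elements. -/
def arrangements {α : Type*} (a b c : α) : Fin 6 → α × α × α :=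
  ![(a, b, c), (b, a, c), (a, c, b), (c, a, b), (b, c, a), (c, b, a)]

theorem arrangements_injective {α : Type*} {a b c : α} (hab : a ≠ b) (hac : a ≠ c) (hbc : b ≠ c) :
    Function.Injective (arrangements a b c) := by
  intro i j h
  have := hab.symm
  have := hac.symm
  have := hbc.symm
  fin_cases i <;> fin_cases j <;> simp_all [arrangements]

theorem eq_zero_of_six_sum_eq_zero {F : Type*} [Field F] {M : Type*} [AddCommGroup M] [Module F M]
    [IsAlgClosed F] [FiniteDimensional F M] {n : ℕ} {x : Fin n → Module.End F M}
    (hx : ∀ k, (x k).IsSemisimple) (hc : ∀ i j, x i * x j = x j * x i)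
    {χ₀ χ₁ χ₂ χ₃ χ₄ χ₅ : Fin n → F}
    (hχ : Function.Injective ![χ₀, χ₁, χ₂, χ₃, χ₄, χ₅]) {r₀ r₁ r₂ r₃ r₄ r₅ : M}
    (h₀ : r₀ ∈ sqEigenspace x χ₀) (h₁ : r₁ ∈ sqEigenspace x χ₁) (h₂ : r₂ ∈ sqEigenspace x χ₂)
    (h₃ : r₃ ∈ sqEigenspace x χ₃) (h₄ : r₄ ∈ sqEigenspace x χ₄) (h₅ : r₅ ∈ sqEigenspace x χ₅)
    (h : r₀ + r₁ + r₂ + r₃ + r₄ + r₅ = 0) :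
    r₀ = 0 ∧ r₁ = 0 ∧ r₂ = 0 ∧ r₃ = 0 ∧ r₄ = 0 ∧ r₅ = 0 := by
  have key := eq_zero_of_sum_eq_zero hx hc hχ (v := ![r₀, r₁, r₂, r₃, r₄, r₅])
    (by intro i; fin_cases i <;> assumption) (by rw [Fin.sum_univ_six]; exact h)
  exact ⟨key 0, key 1, key 2, key 3, key 4, key 5⟩

namespace AffineSystem

variable {F : Type*} [Field F] {M : Type*} [AddCommGroup M] [Module F M] {n : ℕ}

/-- The property which characterises the twisted simple transpositions. -/
def IsTwist (s : ∀ k, k + 1 < n → Module.End F M) (x c : Fin n → Module.End F M)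
    (T : ∀ k, k + 1 < n → Module.End F M) : Prop :=
  ∀ k h χ, ∀ v ∈ sqEigenspace x χ, T k h v = (χ (hi k h) - χ (lo k h))⁻¹ •
    (cross x c k h v + linkFactor (χ (lo k h)) (χ (hi k h)) • inter s x c k h v)

variable {s : ∀ k, k + 1 < n → Module.End F M} {x c : Fin n → Module.End F M}
  {T : ∀ k, k + 1 < n → Module.End F M}

theorem exists_isTwist [IsAlgClosed F] [FiniteDimensional F M] (A : AffineSystem s x c)
    (hx : ∀ k, (x k).IsSemisimple) : ∃ T, IsTwist s x c T := by
  have := fun k h => exists_end_eqOn_sqEigenspace hx A.x_comm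
    fun χ => (χ (hi k h) - χ (lo k h))⁻¹ •
      (cross x c k h + linkFactor (χ (lo k h)) (χ (hi k h)) • inter s x c k h)
  choose T hT using this
  exact ⟨T, fun k h χ v hv => by rw [hT k h χ v hv]; rfl⟩

theorem inter_mul_x {R : Type*} [Ring R] {s : ∀ k, k + 1 < n → R} {x c : Fin n → R}
    (A : AffineSystem s x c) (k : ℕ) (h : k + 1 < n) (i : Fin n) :
    inter s x c k h * x i = x (adjSwap k h i) * inter s x c k h := by
  by_cases h1 : (i : ℕ) = k
  · obtain rfl : i = lo k h := Fin.ext h1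
    rw [adjSwap_apply_left]
    exact (A.rankOne k h).twine_x
  · by_cases h2 : (i : ℕ) = k + 1
    · obtain rfl : i = hi k h := Fin.ext h2
      rw [adjSwap_apply_right]
      exact (A.rankOne k h).twine_y
    · rw [adjSwap_apply_of_ne k h h1 h2]
      exact (A.x_inter_far k h i h1 h2).symm

theorem inter_mul_c {R : Type*} [Ring R] {s : ∀ k, k + 1 < n → R} {x c : Fin n → R}
    (A : AffineSystem s x c) (k : ℕ) (h : k + 1 < n) (i : Fin n) :
    inter s x c k h * c i = c (adjSwap k h i) * inter s x c k h := by
  by_cases h1 : (i : ℕ) = k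
  · obtain rfl : i = lo k h := Fin.ext h1
    rw [adjSwap_apply_left]
    exact (A.rankOne k h).twine_c
  · by_cases h2 : (i : ℕ) = k + 1
    · obtain rfl : i = hi k h := Fin.ext h2
      rw [adjSwap_apply_right]
      exact (A.rankOne k h).twine_d
    · rw [adjSwap_apply_of_ne k h h1 h2]
      exact (A.c_inter_far k h i h1 h2).symm

theorem inter_mul_crossing {R : Type*} [Ring R] {s : ∀ k, k + 1 < n → R} {x c : Fin n → R}
    (A : AffineSystem s x c) (k : ℕ) (h : k + 1 < n) (i j : Fin n) :
    inter s x c k h * crossing (x i) (x j) (c i) (c j)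
      = crossing (x (adjSwap k h i)) (x (adjSwap k h j)) (c (adjSwap k h i)) (c (adjSwap k h j))
        * inter s x c k h := by
  rw [crossing, crossing, mul_add, mul_add, add_mul, add_mul, ← mul_assoc, ← mul_assoc,
    A.inter_mul_c, mul_assoc (c _) _ (c _), A.inter_mul_c, mul_assoc, mul_assoc, mul_sub,
    A.inter_mul_x, A.inter_mul_x, ← sub_mul]
  simp only [mul_assoc]

variable (hT : IsTwist s x c T)
include hT

theorem IsTwist.mem {A : AffineSystem s x c} {χ : Fin n → F} {v : M}
    (hv : v ∈ sqEigenspace x χ) (k : ℕ) (h : k + 1 < n) {N : Submodule F M}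
    (h1 : sqEigenspace x χ ≤ N)
    (h2 : (χ (lo k h) - χ (hi k h)) ^ 2 ≠ 2 * (χ (lo k h) + χ (hi k h)) →
      sqEigenspace x (χ ∘ adjSwap k h) ≤ N) : T k h v ∈ N := by
  rw [hT k h χ v hv]
  refine N.smul_mem _ (N.add_mem (h1 (A.cross_mem hv k h)) ?_)
  by_cases hl : (χ (lo k h) - χ (hi k h)) ^ 2 = 2 * (χ (lo k h) + χ (hi k h))
  · rw [linkFactor_of_eq hl, zero_smul]; exact N.zero_mem
  · exact N.smul_mem _ (h2 hl (A.inter_mem hv k h))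

variable [IsAlgClosed F] [FiniteDimensional F M] (A : AffineSystem s x c)
  (hx : ∀ k, (x k).IsSemisimple)
include A hx

/-- On each eigenspace T combines `cross` and `inter` with coefficients depending only on the
weight, and e preserves weights; relations shared by `cross` and `inter` thus pass to T. -/
theorem IsTwist.mul_eq_mul {e e' : Module.End F M} (k : ℕ) (h : k + 1 < n)
    (he : ∀ i, Commute (x i * x i) e) (h1 : cross x c k h * e = e' * cross x c k h)
    (h2 : inter s x c k h * e = e' * inter s x c k h) : T k h * e = e' * T k h := by
  refine end_ext_sqEigenspace hx A.x_comm fun χ v hv => ?_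
  have h1' := LinearMap.congr_fun h1 v
  have h2' := LinearMap.congr_fun h2 v
  simp only [Module.End.mul_apply] at h1' h2' ⊢
  rw [hT k h χ v hv, hT k h χ _ (mem_of_commute he hv), h1', h2', map_smul, map_add, map_smul]

theorem IsTwist.mul_c (k : ℕ) (h : k + 1 < n) (i : Fin n) :
    T k h * c i = c (adjSwap k h i) * T k h := by
  refine hT.mul_eq_mul A hx k h (fun _ => A.x_sq_c _ _) ?_ (A.inter_mul_c k h i)
  by_cases h1 : (i : ℕ) = k
  · obtain rfl : i = lo k h := Fin.ext h1
    rw [adjSwap_apply_left]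
    exact (A.rankOne k h).crossing_c
  · by_cases h2 : (i : ℕ) = k + 1
    · obtain rfl : i = hi k h := Fin.ext h2
      rw [adjSwap_apply_right]
      exact (A.rankOne k h).crossing_d
    · rw [adjSwap_apply_of_ne k h h1 h2]
      exact (A.c_cross_far k h i h1 h2).symm

/-- The crossing and intertwining elements of disjoint pairs commute, and exchanging one pair does
not change the eigenvalues, hence the coefficients, belonging to the other. -/
theorem IsTwist.commute_far {k l : ℕ} (hk : k + 1 < n) (hl : l + 1 < n) (hkl : k + 1 < l) :
    T k hk * T l hl = T l hl * T k hk := by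
  refine end_ext_sqEigenspace hx A.x_comm fun χ v hv => ?_
  have e1 : ∀ j : Fin n, (j : ℕ) = k ∨ (j : ℕ) = k + 1 → adjSwap l hl j = j :=
    fun j hj => adjSwap_apply_of_ne _ _ (by omega) (by omega)
  have e2 : ∀ j : Fin n, (j : ℕ) = l ∨ (j : ℕ) = l + 1 → adjSwap k hk j = j :=
    fun j hj => adjSwap_apply_of_ne _ _ (by omega) (by omega)
  have c1 : ∀ j : Fin n, (j : ℕ) = l ∨ (j : ℕ) = l + 1 → Commute (cross x c k hk) (x j) :=
    fun j hj => (A.x_cross_far k hk j (by omega) (by omega)).symm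
  have c2 : ∀ j : Fin n, (j : ℕ) = l ∨ (j : ℕ) = l + 1 → Commute (cross x c k hk) (c j) :=
    fun j hj => (A.c_cross_far k hk j (by omega) (by omega)).symm
  have c3 : ∀ j : Fin n, (j : ℕ) = l ∨ (j : ℕ) = l + 1 → Commute (inter s x c k hk) (x j) :=
    fun j hj => (A.x_inter_far k hk j (by omega) (by omega)).symm
  have c4 : ∀ j : Fin n, (j : ℕ) = l ∨ (j : ℕ) = l + 1 → Commute (inter s x c k hk) (c j) :=
    fun j hj => (A.c_inter_far k hk j (by omega) (by omega)).symm
  have c5 : ∀ j : Fin n, (j : ℕ) = k ∨ (j : ℕ) = k + 1 → Commute (s l hl) (x j) :=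
    fun j hj => A.s_x_far l hl j (by omega) (by omega)
  have c6 : ∀ j : Fin n, (j : ℕ) = k ∨ (j : ℕ) = k + 1 → Commute (s l hl) (c j) :=
    fun j hj => A.s_c_far l hl j (by omega) (by omega)
  have e3 := (c2 (lo l hl) (by simp)).mul_right (c2 (hi l hl) (by simp))
  have e4 := (c4 (lo l hl) (by simp)).mul_right (c4 (hi l hl) (by simp))
  have e5 := (c6 (lo k hk) (by simp)).mul_right (c6 (hi k hk) (by simp))
  have d1 : Commute (s l hl) (cross x c k hk) :=
    commute_crossing (c5 _ (by simp)) (c5 _ (by simp)) e5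
  have d2 : Commute (s l hl) (inter s x c k hk) := commute_twine
    (A.s_comm k l hk hl hkl).symm (c5 _ (by simp)) (c5 _ (by simp)) e5
  have m1 : Commute (cross x c k hk) (cross x c l hl) := commute_crossing (c1 _ (by simp))
    (c1 _ (by simp)) e3
  have m2 : Commute (cross x c k hk) (inter s x c l hl) := commute_twine d1.symm (c1 _ (by simp))
    (c1 _ (by simp)) e3
  have m3 : Commute (inter s x c k hk) (cross x c l hl) := commute_crossing (c3 _ (by simp))
    (c3 _ (by simp)) e4
  have m4 : Commute (inter s x c k hk) (inter s x c l hl) := commute_twine d2.symm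
    (c3 _ (by simp)) (c3 _ (by simp)) e4
  have m1' := LinearMap.congr_fun m1.eq v
  have m2' := LinearMap.congr_fun m2.eq v
  have m3' := LinearMap.congr_fun m3.eq v
  have m4' := LinearMap.congr_fun m4.eq v
  simp only [Module.End.mul_apply] at m1' m2' m3' m4' ⊢
  rw [hT k hk χ v hv, hT l hl χ v hv, map_smul, map_add, map_smul, map_smul, map_add, map_smul,
    hT k hk χ _ (A.cross_mem hv l hl), hT k hk _ _ (A.inter_mem hv l hl),
    hT l hl χ _ (A.cross_mem hv k hk), hT l hl _ _ (A.inter_mem hv k hk)]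
  simp only [Function.comp_apply, e1 (lo k hk) (by simp), e1 (hi k hk) (by simp),
    e2 (lo l hl) (by simp), e2 (hi l hl) (by simp), m1', m2', m3', m4']
  module

/-- The crossing part alone produces the error term 1 + cd. The intertwining part satisfies the
homogeneous relation p x = y p, so rescaling it by the link factor does no harm. -/
theorem IsTwist.mul_x (h2 : (2 : F) ≠ 0) (k : ℕ) (h : k + 1 < n) :
    T k h * x (lo k h) = x (hi k h) * T k h - (1 + c (lo k h) * c (hi k h)) := by
  refine end_ext_sqEigenspace hx A.x_comm fun χ v hv => ?_
  by_cases hv0 : v = 0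
  · simp [hv0]
  have hne := sub_ne_zero.2 (A.lo_ne_hi hx h2 hv hv0 k h).symm
  have e1 := LinearMap.congr_fun (A.rankOne k h).crossing_x v
  have e2 := LinearMap.congr_fun (A.rankOne k h).twine_x v
  have hm := mem_sqEigenspace.1 hv
  change (cross x c k h * x (lo k h)) v = _ at e1
  change (inter s x c k h * x (lo k h)) v = (x (hi k h) * inter s x c k h) v at e2
  have e3 : (crossing (x (lo k h)) (x (hi k h)) (c (lo k h)) (c (hi k h))) = cross x c k h := rfl
  rw [e3] at e1
  simp only [Module.End.mul_apply, LinearMap.sub_apply, LinearMap.add_apply, Module.End.one_apply,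
    hm, ← sub_smul, map_smul] at e1 e2 ⊢
  rw [hT k h χ v hv, hT k h χ _ (A.x_mem hv _), e1, e2]
  simp only [map_add, map_smul]
  rw [sub_add_eq_add_sub, smul_sub, smul_smul, inv_mul_cancel₀ hne, one_smul]

/-- On a linked pair with values a, b only the crossing part survives, and its square is 2(a + b)/(a
- b)² = 1. On an unlinked pair the mixed terms cancel, since p reverses the sign of the difference
of the values. -/
theorem IsTwist.mul_self (h2 : (2 : F) ≠ 0) (k : ℕ) (h : k + 1 < n) : T k h * T k h = 1 := by
  refine end_ext_sqEigenspace hx A.x_comm fun χ v hv => ?_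
  by_cases hv0 : v = 0
  · simp [hv0]
  have hne := sub_ne_zero.2 (A.lo_ne_hi hx h2 hv hv0 k h).symm
  have e1 := LinearMap.congr_fun (A.rankOne k h).twine_crossing v
  change inter s x c k h (cross x c k h v) = cross x c k h (inter s x c k h v) at e1
  rw [Module.End.mul_apply, hT k h χ v hv, map_smul, map_add, map_smul,
    hT k h χ _ (A.cross_mem hv k h), hT k h _ _ (A.inter_mem hv k h), A.cross_cross_apply hv,
    A.inter_inter_apply hv, e1]
  simp only [Function.comp_apply, adjSwap_apply_left, adjSwap_apply_right, Module.End.one_apply]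
  rw [linkFactor_comm (χ (hi k h)), ← neg_sub (χ (hi k h)), inv_neg]
  by_cases hl : (χ (lo k h) - χ (hi k h)) ^ 2 = 2 * (χ (lo k h) + χ (hi k h))
  · rw [linkFactor_of_eq hl, zero_smul, zero_smul, add_zero, add_zero, smul_smul, smul_smul, ← hl]
    have : (χ (hi k h) - χ (lo k h))⁻¹ * (χ (hi k h) - χ (lo k h))⁻¹
        * (χ (lo k h) - χ (hi k h)) ^ 2 = 1 := by
      field_simp
      ring
    rw [this, one_smul]
  · rw [linkFactor_of_ne hl]
    match_scalars
    · field_simp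
      ring
    · ring

theorem IsTwist.exists_parts (h2 : (2 : F) ≠ 0) (k : ℕ) (h : k + 1 < n) :
    ∃ a p : Module.End F M, s k h = a + p ∧
      (∀ χ, ∀ v ∈ sqEigenspace x χ,
        a v = (χ (hi k h) - χ (lo k h))⁻¹ • cross x c k h v) ∧
      (∀ χ, ∀ v ∈ sqEigenspace x χ,
        p v = (χ (hi k h) - χ (lo k h))⁻¹ • inter s x c k h v) ∧
      ∀ χ, ∀ v ∈ sqEigenspace x χ,
        T k h v = a v + linkFactor (χ (lo k h)) (χ (hi k h)) • p v := by
  obtain ⟨a, ha⟩ := exists_end_eqOn_sqEigenspace hx A.x_comm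
    fun χ => (χ (hi k h) - χ (lo k h))⁻¹ • cross x c k h
  have hp : ∀ χ, ∀ v ∈ sqEigenspace x χ,
      (s k h - a) v = (χ (hi k h) - χ (lo k h))⁻¹ • inter s x c k h v := by
    intro χ v hv
    by_cases hv0 : v = 0
    · simp [hv0]
    have hne := sub_ne_zero.2 (A.lo_ne_hi hx h2 hv hv0 k h).symm
    rw [inter_apply hv, LinearMap.sub_apply, ha χ v hv, smul_sub, smul_smul,
      inv_mul_cancel₀ hne, one_smul]
    rfl
  refine ⟨a, s k h - a, by abel, ha, hp, fun χ v hv => ?_⟩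
  rw [hT k h χ v hv, ha χ v hv, hp χ v hv, LinearMap.smul_apply, smul_add, smul_comm]

/-- Expand the braid relation of the s's into weight components. If the three values are distinct
there are six components, and twisting multiplies all terms of an off-diagonal component by the same
product of link factors. In the diagonal one, a a' a keeps coefficient 1 while p a' p acquires the
square of a link factor; this is harmless because p a' p vanishes whenever that factor is 0. -/
theorem IsTwist.braid (h2 : (2 : F) ≠ 0) (k : ℕ) (h : k + 1 < n) (h' : k + 1 + 1 < n) :
    T k h * T (k + 1) h' * T k h = T (k + 1) h' * T k h * T (k + 1) h' := by
  obtain ⟨a, p, hs, ha, hp, hTa⟩ := hT.exists_parts A hx h2 k h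
  obtain ⟨a', p', hs', ha', hp', hTa'⟩ := hT.exists_parts A hx h2 (k + 1) h'
  have am : ∀ χ, ∀ v ∈ sqEigenspace x χ, a v ∈ sqEigenspace x χ := fun χ v hv => by
    rw [ha χ v hv]; exact Submodule.smul_mem _ _ (A.cross_mem hv k h)
  have am' : ∀ χ, ∀ v ∈ sqEigenspace x χ, a' v ∈ sqEigenspace x χ := fun χ v hv => by
    rw [ha' χ v hv]; exact Submodule.smul_mem _ _ (A.cross_mem hv _ h')
  have pm : ∀ χ, ∀ v ∈ sqEigenspace x χ, p v ∈ sqEigenspace x (χ ∘ adjSwap k h) :=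
    fun χ v hv => by rw [hp χ v hv]; exact Submodule.smul_mem _ _ (A.inter_mem hv k h)
  have pm' : ∀ χ, ∀ v ∈ sqEigenspace x χ, p' v ∈ sqEigenspace x (χ ∘ adjSwap (k + 1) h') :=
    fun χ v hv => by rw [hp' χ v hv]; exact Submodule.smul_mem _ _ (A.inter_mem hv _ h')
  refine end_ext_sqEigenspace hx A.x_comm fun χ v hv => ?_
  by_cases hv0 : v = 0
  · simp [hv0]
  have hXY := A.lo_ne_hi hx h2 hv hv0 k h
  have hYZ := A.lo_ne_hi hx h2 hv hv0 (k + 1) h'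
  have braid := LinearMap.congr_fun (A.s_braid k h h') v
  rw [hs, hs'] at braid
  simp only [Module.End.mul_apply, LinearMap.add_apply, map_add] at braid ⊢
  have s1 : adjSwap k h (lo k h) = hi k h := adjSwap_apply_left k h
  have s2 : adjSwap k h (lo (k + 1) h') = lo k h := adjSwap_apply_right k h
  have s3 : adjSwap k h (hi (k + 1) h') = hi (k + 1) h' :=
    adjSwap_apply_of_ne _ _ (by simp; omega) (by simp)
  have t1 : adjSwap (k + 1) h' (lo k h) = lo k h :=
    adjSwap_apply_of_ne _ _ (by simp) (by simp; omega)
  have t2 : adjSwap (k + 1) h' (hi k h) = hi (k + 1) h' := adjSwap_apply_left _ _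
  have t3 : adjSwap (k + 1) h' (hi (k + 1) h') = hi k h := adjSwap_apply_right _ _
  have s2' : adjSwap k h (hi k h) = lo k h := s2
  have t2' : adjSwap (k + 1) h' (lo (k + 1) h') = hi (k + 1) h' := t2
  have hmid : lo (k + 1) h' = hi k h := rfl
  -- Equal outer values would be brought side by side by p or p', which `lo_ne_hi` forbids; hence
  -- both vanish on this eigenspace and only the crossing parts remain.
  by_cases hXZ : χ (lo k h) = χ (hi (k + 1) h')
  · have p0 : ∀ w ∈ sqEigenspace x χ, p w = 0 := fun w hw => by
      by_contra hne
      refine A.lo_ne_hi hx h2 (pm χ w hw) hne (k + 1) h' ?_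
      simp only [Function.comp_apply, s2, s3, hXZ]
    have p0' : ∀ w ∈ sqEigenspace x χ, p' w = 0 := fun w hw => by
      by_contra hne
      refine A.lo_ne_hi hx h2 (pm' χ w hw) hne k h ?_
      simp only [Function.comp_apply, t1, t2, hXZ]
    have e : ∀ w ∈ sqEigenspace x χ, T k h w = a w := fun w hw => by
      rw [hTa χ w hw, p0 w hw, smul_zero, add_zero]
    have e' : ∀ w ∈ sqEigenspace x χ, T (k + 1) h' w = a' w := fun w hw => by
      rw [hTa' χ w hw, p0' w hw, smul_zero, add_zero]
    have q1 := am χ v hv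
    have q2 := am' χ v hv
    have q3 := am' χ _ q1
    have q4 := am χ _ q2
    rw [p0 v hv, p0' v hv, p0' _ q1, p0 _ q2, p0 _ q3, p0' _ q4] at braid
    simp only [map_zero, add_zero] at braid
    rw [e v hv, e' v hv, e' _ q1, e _ q2, e _ q3, e' _ q4, braid]
  set σ := adjSwap k h with hσ
  set τ := adjSwap (k + 1) h' with hτ
  have hbr : σ * τ * σ = τ * σ * τ := adjSwap_braid k h h'
  have A0 := am χ v hv
  have P0 := pm χ v hv
  have A0' := am' χ v hv
  have P0' := pm' χ v hv
  have AA := am' _ _ A0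
  have AP := pm' _ _ A0
  have PA := am' _ _ P0
  have PP := pm' _ _ P0
  have AA' := am _ _ A0'
  have AP' := pm _ _ A0'
  have PA' := am _ _ P0'
  have PP' := pm _ _ P0'
  -- In the linked case the middle crossing is moved to the left of the intertwiner, leaving the
  -- square of the intertwiner, which is 0.
  have killp : ∀ ψ, ∀ w ∈ sqEigenspace x ψ,
      linkFactor (ψ (lo k h)) (ψ (hi k h)) • p (a' (p w)) = p (a' (p w)) := by
    intro ψ w hw
    by_cases hl : (ψ (lo k h) - ψ (hi k h)) ^ 2 = 2 * (ψ (lo k h) + ψ (hi k h))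
    · have e1 := LinearMap.congr_fun (A.inter_mul_crossing k h (lo (k + 1) h') (hi (k + 1) h'))
        (inter s x c k h w)
      simp only [Module.End.mul_apply] at e1
      rw [A.inter_inter_apply hw, ← hl, ← neg_sub (ψ (hi k h)), neg_sq, sub_self, zero_smul,
        map_zero] at e1
      have e2 : p (a' (p w)) = 0 := by
        rw [hp _ _ (am' _ _ (pm _ _ hw)), ha' _ _ (pm _ _ hw), hp _ _ hw, map_smul, map_smul,
          map_smul]
        simp only [cross, e1, smul_zero]
      rw [e2, smul_zero]
    · rw [linkFactor_of_ne hl, one_smul]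
  have killp' : ∀ ψ, ∀ w ∈ sqEigenspace x ψ,
      linkFactor (ψ (hi k h)) (ψ (hi (k + 1) h')) • p' (a (p' w)) = p' (a (p' w)) := by
    intro ψ w hw
    by_cases hl : (ψ (hi k h) - ψ (hi (k + 1) h')) ^ 2 = 2 * (ψ (hi k h) + ψ (hi (k + 1) h'))
    · have e1 := LinearMap.congr_fun (A.inter_mul_crossing (k + 1) h' (lo k h) (hi k h))
        (inter s x c (k + 1) h' w)
      simp only [Module.End.mul_apply] at e1
      rw [A.inter_inter_apply hw, ← hl, ← neg_sub (ψ (hi (k + 1) h')), neg_sq, sub_self, zero_smul,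
        map_zero] at e1
      have e2 : p' (a (p' w)) = 0 := by
        rw [hp' _ _ (am _ _ (pm' _ _ hw)), ha _ _ (pm' _ _ hw), hp' _ _ hw, map_smul, map_smul,
          map_smul]
        simp only [cross, e1, smul_zero]
      rw [e2, smul_zero]
    · rw [linkFactor_of_ne hl, one_smul]
  have hq := killp χ v hv
  have hq' := killp' χ v hv
  have cσ : ∀ ψ : Fin n → F, (ψ ∘ σ) ∘ σ = ψ := fun ψ => by
    rw [Function.comp_assoc, ← Equiv.Perm.coe_mul, hσ, adjSwap_mul_self]; rfl
  have cτ : ∀ ψ : Fin n → F, (ψ ∘ τ) ∘ τ = ψ := fun ψ => by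
    rw [Function.comp_assoc, ← Equiv.Perm.coe_mul, hτ, adjSwap_mul_self]; rfl
  have cbr : ((χ ∘ τ) ∘ σ) ∘ τ = ((χ ∘ σ) ∘ τ) ∘ σ := by
    simp only [Function.comp_assoc, ← Equiv.Perm.coe_mul, hbr]
  have hξ : Function.Injective
      ![χ, χ ∘ σ, χ ∘ τ, (χ ∘ τ) ∘ σ, (χ ∘ σ) ∘ τ, ((χ ∘ σ) ∘ τ) ∘ σ] := by
    refine Function.Injective.of_comp (f := fun ψ : Fin n → F =>
      (ψ (lo k h), ψ (hi k h), ψ (hi (k + 1) h'))) ?_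
    convert arrangements_injective hXY hXZ hYZ using 1
    funext i
    fin_cases i <;> simp [arrangements, s1, s2', s3, t1, t2, t3]
  have B0 := am _ _ AA
  have B1 := pm _ _ PA
  have B2 := am' _ _ AA'
  have B3 := pm' _ _ PA'
  rw [cσ] at B1
  rw [cτ] at B3
  have B7 := pm' _ _ PP'
  rw [cbr] at B7
  obtain ⟨z0, z1, z2, z3, z4, z5⟩ := eq_zero_of_six_sum_eq_zero hx A.x_comm hξ
    (sub_mem (add_mem B0 B1) (add_mem B2 B3))
    (sub_mem (add_mem (pm _ _ AA) (am _ _ PA)) (am' _ _ AP'))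
    (sub_mem (am _ _ AP) (add_mem (pm' _ _ AA') (am' _ _ PA')))
    (sub_mem (pm _ _ AP) (am' _ _ PP')) (sub_mem (am _ _ PP) (pm' _ _ AP'))
    (sub_mem (pm _ _ PP) B7) (by
      rw [← sub_eq_zero] at braid
      rw [← braid]
      abel)
  rw [hTa χ v hv, hTa' χ v hv]
  simp only [map_add, map_smul, hTa' _ _ A0, hTa' _ _ P0, hTa _ _ A0', hTa _ _ P0']
  simp only [hTa _ _ AA, hTa _ _ AP, hTa _ _ PA, hTa _ _ PP, hTa' _ _ AA', hTa' _ _ AP',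
    hTa' _ _ PA', hTa' _ _ PP']
  simp only [Function.comp_apply, s1, s2, s3, t1, t2, t3, hmid]
  rw [linkFactor_comm (χ (hi k h)) (χ (lo k h)),
    linkFactor_comm (χ (hi (k + 1) h')) (χ (hi k h))]
  generalize linkFactor (χ (lo k h)) (χ (hi k h)) = f1 at *
  generalize linkFactor (χ (hi k h)) (χ (hi (k + 1) h')) = f2 at *
  generalize linkFactor (χ (lo k h)) (χ (hi (k + 1) h')) = f3 at *
  -- The coefficients of z1 to z5 are the link factors met on the way to each arrangement. The
  -- multiples of hq and hq' reduce f² to 1 in the diagonal component, through f² - 1 = (f + 1)(f -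
  -- 1).
  linear_combination (norm := module) z0 + f1 • z1 + f2 • z2 + (f2 * f3) • z3 + (f1 * f3) • z4
    + (f1 * f2 * f3) • z5 + (f1 + 1) • hq - (f2 + 1) • hq'

end AffineSystem

end Twist

/-! ### Arithmetic of the values q(i) -/

section Integrality

variable {F : Type*} [Field F] {p : ℕ} [CharP F p]

theorem char_eq_zero_or_odd (F : Type*) [Field F] {p : ℕ} [CharP F p] (hp : p ≠ 2) :
    p = 0 ∨ ∃ m, 0 < m ∧ p = 2 * m + 1 := by
  rcases CharP.char_is_prime_or_zero F p with h | h
  · obtain ⟨m, hm⟩ := h.odd_of_ne_two hp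
    exact Or.inr ⟨m, by have := h.two_le; omega, hm⟩
  · exact Or.inl h

theorem two_ne_zero_of_char_ne_two (hp : p ≠ 2) : (2 : F) ≠ 0 := by
  intro h
  have h1 : ((2 : ℕ) : F) = 0 := by exact_mod_cast h
  rw [CharP.cast_eq_zero_iff F p] at h1
  rcases char_eq_zero_or_odd F hp with rfl | ⟨m, hm, rfl⟩
  · simp at h1
  · have := Nat.le_of_dvd (by norm_num) h1
    omega

theorem intCast_eq_zero_of_abs_lt {a : ℤ} (h : (a : F) = 0) (ha : p = 0 ∨ |a| < p) : a = 0 := by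
  rw [CharP.intCast_eq_zero_iff F p] at h
  rcases ha with rfl | ha
  · simpa using h
  · exact Int.eq_zero_of_abs_lt_dvd h ha

/-- With d = i - j and e = i + j + 1 one has q(i) - q(j) = de and 2(q(i) + q(j)) = d² + e² - 1, so
the difference is (d² - 1)(e² - 1). -/
theorem q_sub_sq (i j : ℕ) : ((q i : F) - q j) ^ 2 - 2 * (q i + q j)
    = (((i : ℤ) - j - 1 : ℤ) : F) * (((i : ℤ) - j + 1 : ℤ) : F) * (((i : ℤ) + j : ℤ) : F)
      * (((i : ℤ) + j + 2 : ℤ) : F) := by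
  simp only [q]
  push_cast
  ring

theorem q_linked_of_succ (i : ℕ) : ((q i : F) - q (i + 1)) ^ 2 = 2 * (q i + q (i + 1)) := by
  simp only [q]
  push_cast
  ring

/-- Linked values of `q` come from neighbouring elements of the index set. -/
theorem eq_succ_of_q_linked (hp : p ≠ 2) {i j : ℕ} (hi : i ∈ indexSet p) (hj : j ∈ indexSet p)
    (hij : i ≠ j) (h : ((q i : F) - q j) ^ 2 = 2 * (q i + q j)) : i = j + 1 ∨ j = i + 1 := by
  rw [← sub_eq_zero, q_sub_sq] at h
  simp only [indexSet, Set.mem_ofPred_eq] at hi hj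
  rcases char_eq_zero_or_odd F hp with hp0 | ⟨m, hm, hpm⟩
  · rcases mul_eq_zero.1 h with h | h
    · rcases mul_eq_zero.1 h with h | h
      · rcases mul_eq_zero.1 h with h | h
        · have := intCast_eq_zero_of_abs_lt (F := F) h (Or.inl hp0); omega
        · have := intCast_eq_zero_of_abs_lt (F := F) h (Or.inl hp0); omega
      · have := intCast_eq_zero_of_abs_lt (F := F) h (Or.inl hp0); omega
    · have := intCast_eq_zero_of_abs_lt (F := F) h (Or.inl hp0); omega
  · rcases mul_eq_zero.1 h with h | h
    · rcases mul_eq_zero.1 h with h | h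
      · rcases mul_eq_zero.1 h with h | h
        · have := intCast_eq_zero_of_abs_lt (F := F) h (Or.inr (abs_lt.2 (by omega))); omega
        · have := intCast_eq_zero_of_abs_lt (F := F) h (Or.inr (abs_lt.2 (by omega))); omega
      · have := intCast_eq_zero_of_abs_lt (F := F) h (Or.inr (abs_lt.2 (by omega))); omega
    · have h0 : (((i : ℤ) + j + 2 - p : ℤ) : F) = 0 := by
        push_cast at h ⊢
        rw [h, CharP.cast_eq_zero, sub_zero]
      have := intCast_eq_zero_of_abs_lt (F := F) h0 (Or.inr (abs_lt.2 (by omega)))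
      omega

theorem q_injOn (hp : p ≠ 2) {i j : ℕ} (hi : i ∈ indexSet p) (hj : j ∈ indexSet p)
    (h : (q i : F) = q j) : i = j := by
  have h : (((i : ℤ) - j : ℤ) : F) * (((i : ℤ) + j + 1 : ℤ) : F) = 0 := by
    rw [← sub_eq_zero] at h
    rw [← h]
    simp only [q]
    push_cast
    ring
  simp only [indexSet, Set.mem_ofPred_eq] at hi hj
  rcases char_eq_zero_or_odd F hp with hp0 | ⟨m, hm, hpm⟩
  · rcases mul_eq_zero.1 h with h | h
    · have := intCast_eq_zero_of_abs_lt (F := F) h (Or.inl hp0); omega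
    · have := intCast_eq_zero_of_abs_lt (F := F) h (Or.inl hp0); omega
  · rcases mul_eq_zero.1 h with h | h
    · have := intCast_eq_zero_of_abs_lt (F := F) h (Or.inr (abs_lt.2 (by omega))); omega
    · have h0 : (((i : ℤ) + j + 1 - p : ℤ) : F) = 0 := by
        push_cast at h ⊢
        rw [h, CharP.cast_eq_zero, sub_zero]
      have := intCast_eq_zero_of_abs_lt (F := F) h0 (Or.inr (abs_lt.2 (by omega)))
      omega

/-- As a quadratic equation in b, being linked to q(j) has the roots q(j + 1) and (j - 1)j; the
point is that these values stay within the index set at both of its ends. -/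
theorem exists_q_of_linked (hp : p ≠ 2) {j : ℕ} (hj : j ∈ indexSet p) {b : F}
    (h : (b - q j) ^ 2 = 2 * (b + q j)) : ∃ i ∈ indexSet p, b = q i := by
  have h1 : (b - q (j + 1)) * (b - ((j : F) - 1) * j) = 0 := by
    have e : (b - q (j + 1)) * (b - ((j : F) - 1) * j) = (b - q j) ^ 2 - 2 * (b + q j) := by
      simp only [q]
      push_cast
      ring
    rw [e, h, sub_self]
  simp only [indexSet, Set.mem_ofPred_eq] at hj ⊢
  have hlow : b = ((j : F) - 1) * j → ∃ i, (p = 0 ∨ i ≤ (p - 1) / 2) ∧ b = q i := by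
    intro hb
    cases j with
    | zero => exact ⟨0, by omega, by rw [hb]; simp [q]⟩
    | succ j => exact ⟨j, by omega, by rw [hb]; simp only [q]; push_cast; ring⟩
  rcases mul_eq_zero.1 h1 with h1 | h1
  · rw [sub_eq_zero] at h1
    by_cases hj' : p = 0 ∨ j + 1 ≤ (p - 1) / 2
    · exact ⟨j + 1, hj', h1⟩
    -- At the upper end 2j + 1 = p, and the two roots coincide, since their difference is 2(2j + 1).
    · apply hlow
      rcases char_eq_zero_or_odd F hp with hp0 | ⟨m, hm, hpm⟩
      · omega
      · have hjm : 2 * j + 1 = p := by omega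
        have h0 : (2 * (j : F) + 1) = 0 := by
          have := CharP.cast_eq_zero F p
          rw [← hjm] at this
          exact_mod_cast this
        rw [h1]
        simp only [q]
        push_cast
        linear_combination 2 * h0
  · exact hlow (sub_eq_zero.1 h1)

end Integrality

/-! ### Weights when the first polynomial generator vanishes -/

section FiniteWeights

section

variable {F : Type*} [Field F] {p : ℕ} [CharP F p] {M : Type*} [AddCommGroup M] [Module F M]
  {n : ℕ} {x : Fin n → Module.End F M}

theorem weight_eq_zero (hp : p ≠ 2)
    (h0 : ∀ k : Fin n, (k : ℕ) = 0 → x k = 0) {l : Fin n → ℕ} (hl : ∀ k, l k ∈ indexSet p) {v : M}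
    (hv : v ∈ sqEigenspace x (fun k => q (l k))) (hv0 : v ≠ 0) (k : Fin n) (hk : (k : ℕ) = 0) :
    l k = 0 := by
  have h1 := mem_sqEigenspace.1 hv k
  rw [h0 k hk, LinearMap.zero_apply, eq_comm, smul_eq_zero] at h1
  refine q_injOn (F := F) hp (hl k) (by simp [indexSet]) ?_
  rw [h1.resolve_right hv0]
  simp [q]

end

variable {F : Type*} [Field F] [IsAlgClosed F] {p : ℕ} [CharP F p] {M : Type*} [AddCommGroup M]
  [Module F M] [FiniteDimensional F M] {n : ℕ} {s : ∀ k, k + 1 < n → Module.End F M}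
  {x c : Fin n → Module.End F M}

namespace AffineSystem

variable (A : AffineSystem s x c) (hx : ∀ k, (x k).IsSemisimple) (hp : p ≠ 2)
  (h0 : ∀ k : Fin n, (k : ℕ) = 0 → x k = 0)
include A hx hp

theorem inter_ne_zero {l : Fin n → ℕ} (hl : ∀ k, l k ∈ indexSet p) {v : M}
    (hv : v ∈ sqEigenspace x (fun k => q (l k))) (hv0 : v ≠ 0) (k : ℕ) (hk : k + 1 < n)
    (hcon : l (lo k hk) ≠ l (hi k hk) + 1 ∧ l (hi k hk) ≠ l (lo k hk) + 1) :
    l (lo k hk) ≠ l (hi k hk) ∧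
      inter s x c k hk v ∈ sqEigenspace x (fun j => q ((l ∘ adjSwap k hk) j)) ∧
      inter s x c k hk v ≠ 0 := by
  have hne : l (lo k hk) ≠ l (hi k hk) := fun e =>
    A.lo_ne_hi hx (two_ne_zero_of_char_ne_two hp) hv hv0 k hk (congrArg q e)
  refine ⟨hne, A.inter_mem hv k hk, fun h => ?_⟩
  have h1 := A.inter_inter_apply hv k hk
  rw [h, map_zero, eq_comm, smul_eq_zero] at h1
  have h2 := h1.resolve_right hv0
  rcases eq_succ_of_q_linked (F := F) hp (hl _) (hl _) hne (by linear_combination -h2) with e | e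
  · exact hcon.1 e
  · exact hcon.2 e

include h0

/-- Induction on the position. If the intertwiner kills the eigenvector, the value is linked to the
preceding one; otherwise the intertwiner moves it one place to the left. -/
theorem exists_q_of_hasEigenvalue (k : ℕ) (hk : k < n) (μ : F)
    (hμ : (x ⟨k, hk⟩ ^ 2).HasEigenvalue μ) : ∃ j ∈ indexSet p, μ = q j := by
  induction k generalizing μ with
  | zero =>
    obtain ⟨v, hv⟩ := hμ.exists_hasEigenvector
    have h1 := hv.apply_eq_smul
    rw [h0 _ rfl, zero_pow two_ne_zero, LinearMap.zero_apply, eq_comm, smul_eq_zero] at h1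
    exact ⟨0, by simp [indexSet], by simp [q, h1.resolve_right hv.2]⟩
  | succ k ih =>
    -- Were μ absent from all simultaneous eigenspaces, inverting χ - μ on each of them would give a
    -- left inverse of x² - μ.
    obtain ⟨χ, hχ, v, hv, hv0⟩ : ∃ χ : Fin n → F, χ ⟨k + 1, hk⟩ = μ ∧
        ∃ v ∈ sqEigenspace x χ, v ≠ 0 := by
      by_contra! hcon
      obtain ⟨e, he⟩ := exists_end_eqOn_sqEigenspace hx A.x_comm
        fun χ => (χ ⟨k + 1, hk⟩ - μ)⁻¹ • 1
      have he1 : e * (x ⟨k + 1, hk⟩ * x ⟨k + 1, hk⟩ - μ • 1) = 1 := by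
        refine end_ext_sqEigenspace hx A.x_comm fun χ v hv => ?_
        by_cases hχ : χ ⟨k + 1, hk⟩ = μ
        · simp [hcon χ hχ v hv]
        · have h1 := he χ v hv
          have h2 := mem_sqEigenspace.1 hv
          simp only [Module.End.mul_apply, LinearMap.sub_apply, LinearMap.smul_apply,
            Module.End.one_apply, h2, ← sub_smul, map_smul] at h1 ⊢
          rw [h1, smul_smul, mul_inv_cancel₀ (sub_ne_zero.2 hχ), one_smul]
      obtain ⟨u, hu⟩ := hμ.exists_hasEigenvector
      have h1 := hu.apply_eq_smul
      have h2 := LinearMap.congr_fun he1 u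
      simp only [Module.End.mul_apply, LinearMap.sub_apply, LinearMap.smul_apply,
        Module.End.one_apply, pow_two] at h1 h2
      rw [h1, sub_self, map_zero] at h2
      exact hu.2 h2.symm
    have hk' : k < n := by omega
    have key : ∀ ψ, ∀ w ∈ sqEigenspace x ψ, w ≠ 0 → ∃ j ∈ indexSet p, ψ ⟨k, hk'⟩ = q j := by
      intro ψ w hw hw0
      refine ih hk' _ (Module.End.hasEigenvalue_of_hasEigenvector (x := w)
        ⟨Module.End.mem_eigenspace_iff.2 ?_, hw0⟩)
      rw [pow_two]
      exact mem_sqEigenspace.1 hw _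
    by_cases hi0 : inter s x c k hk v = 0
    · have h1 := A.inter_inter_apply hv k hk
      rw [hi0, map_zero, eq_comm, smul_eq_zero] at h1
      obtain ⟨j, hj, hj2⟩ := key χ v hv hv0
      have h2 := h1.resolve_right hv0
      rw [hj2, hχ] at h2
      exact exists_q_of_linked hp hj (by linear_combination -h2)
    · obtain ⟨j, hj, hj2⟩ := key _ _ (A.inter_mem hv k hk) hi0
      rw [Function.comp_apply, adjSwap_apply_left, hχ] at hj2
      exact ⟨j, hj, hj2⟩

/-- An entry without an earlier neighbouring integer is moved left by injective intertwiners. Each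
move keeps it among the same earlier entries, so the induction hypothesis supplies the missing
neighbour; in the first two places both entries must be 0, which is impossible. -/
theorem weight_connected (k : ℕ) (hk : k + 1 < n) {l : Fin n → ℕ} (hl : ∀ k, l k ∈ indexSet p)
    {v : M} (hv : v ∈ sqEigenspace x (fun k => q (l k))) (hv0 : v ≠ 0) :
    ∃ j : Fin n, (j : ℕ) < k + 1 ∧ (l j = l (hi k hk) + 1 ∨ l (hi k hk) = l j + 1) := by
  have h2 : (2 : F) ≠ 0 := two_ne_zero_of_char_ne_two hp
  induction k generalizing l v with
  | zero =>
    by_contra! hcon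
    obtain ⟨hne, hw, hw0⟩ := A.inter_ne_zero hx hp hl hv hv0 0 hk (hcon (lo 0 hk) (by simp))
    have e1 := weight_eq_zero hp h0 hl hv hv0 (lo 0 hk) rfl
    have e2 := weight_eq_zero hp h0 (fun k => hl _) hw hw0 (lo 0 hk) rfl
    rw [adjSwap_apply_left] at e2
    exact hne (e1.trans e2.symm)
  | succ k ih =>
    by_contra! hcon
    obtain ⟨hne, hw, hw0⟩ := A.inter_ne_zero hx hp hl hv hv0 (k + 1) hk
      (hcon (lo (k + 1) hk) (by simp))
    obtain ⟨j, hj, hj2⟩ := ih (by omega) (fun k => hl _) hw hw0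
    have e1 : adjSwap (k + 1) hk (hi k (by omega)) = hi (k + 1) hk := adjSwap_apply_left _ _
    rw [e1,
      adjSwap_apply_of_ne _ _ (by omega) (by omega)] at hj2
    have := hcon j (by omega)
    omega

end AffineSystem

end FiniteWeights

/-! ### Supermodules and homogeneous generators -/

section Graded

variable {F : Type*} [Field F] {A : Type*} [Ring A] [Algebra F A] {G : Type*} {gen : G → A}
  {par : G → ZMod 2}

theorem adjoin_range_mkAlgHom (r : FreeAlgebra F G → FreeAlgebra F G → Prop) :
    Algebra.adjoin F (Set.range fun g => RingQuot.mkAlgHom F r (FreeAlgebra.ι F g)) = ⊤ := by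
  have h := congrArg (Subalgebra.map (RingQuot.mkAlgHom F r)) (FreeAlgebra.adjoin_range_ι F G)
  rw [AlgHom.map_adjoin, Algebra.map_top, (AlgHom.range_eq_top _).2
    (RingQuot.mkAlgHom_surjective F r), ← Set.range_comp] at h
  exact h

theorem gradedPart_sup (h : Algebra.adjoin F (Set.range gen) = ⊤) :
    gradedPart (F := F) gen par 0 ⊔ gradedPart gen par 1 = ⊤ := by
  rw [eq_top_iff, ← Algebra.top_toSubmodule, ← h, Algebra.adjoin_eq_span, Submodule.span_le]
  intro a ha
  obtain ⟨l, hl, rfl⟩ := Submonoid.exists_list_of_mem_closure ha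
  obtain ⟨l', rfl⟩ : ∃ l' : List G, l'.map gen = l := by
    clear ha
    induction l with
    | nil => exact ⟨[], rfl⟩
    | cons b l ih =>
      obtain ⟨l', rfl⟩ := ih fun y hy => hl y (List.mem_cons_of_mem _ hy)
      obtain ⟨g, rfl⟩ := hl b List.mem_cons_self
      exact ⟨g :: l', rfl⟩
  have : ∀ d : ZMod 2, d = 0 ∨ d = 1 := by decide
  rcases this (l'.map par).sum with h | h
  · exact Submodule.mem_sup_left (Submodule.subset_span ⟨l', h, rfl⟩)
  · exact Submodule.mem_sup_right (Submodule.subset_span ⟨l', h, rfl⟩)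

theorem gen_mem_gradedPart (g : G) : gen g ∈ gradedPart (F := F) gen par (par g) :=
  Submodule.subset_span ⟨[g], by simp, by simp⟩

variable {M : Type*} [AddCommGroup M] [Module F M] [Module A M] {V : ZMod 2 → Submodule F M}

theorem isSupermodule_of_gen [IsScalarTower F A M] (hV : IsCompl (V 0) (V 1))
    (h : ∀ g e, ∀ v ∈ V e, gen g • v ∈ V (par g + e)) : IsSupermodule (gradedPart gen par) V := by
  refine ⟨hV, fun d e a ha v hv => ?_⟩
  induction ha using Submodule.span_induction with
  | mem a ha =>
    obtain ⟨l, rfl, rfl⟩ := ha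
    induction l with
    | nil => simpa using hv
    | cons g l ih =>
      rw [List.map_cons, List.map_cons, List.prod_cons, List.sum_cons, mul_smul, add_assoc]
      exact h g _ _ ih
  | zero => simp
  | add a b _ _ h1 h2 => rw [add_smul]; exact add_mem h1 h2
  | smul r a _ h1 => rw [smul_assoc]; exact Submodule.smul_mem _ _ h1

/-- A submodule of a supermodule is graded if it contains the homogeneous components of its
elements. -/
def IsGradedSubmodule (V : ZMod 2 → Submodule F M) (N : Submodule A M) : Prop :=
  ∀ v ∈ N, ∃ v₀ ∈ V 0, ∃ v₁ ∈ V 1, v₀ ∈ N ∧ v₁ ∈ N ∧ v = v₀ + v₁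

theorem exists_add_of_isCompl (hV : IsCompl (V 0) (V 1)) (v : M) :
    ∃ v₀ ∈ V 0, ∃ v₁ ∈ V 1, v = v₀ + v₁ := by
  have : v ∈ V 0 ⊔ V 1 := by rw [hV.sup_eq_top]; trivial
  obtain ⟨a, ha, b, hb, rfl⟩ := Submodule.mem_sup.1 this
  exact ⟨a, ha, b, hb, rfl⟩

theorem eq_and_eq_of_add_eq_add (hV : IsCompl (V 0) (V 1)) {a a' b b' : M} (ha : a ∈ V 0)
    (ha' : a' ∈ V 0) (hb : b ∈ V 1) (hb' : b' ∈ V 1) (h : a + b = a' + b') :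
    a = a' ∧ b = b' := by
  have h1 : a - a' = b' - b := by rw [sub_eq_sub_iff_add_eq_add, h, add_comm]
  have h2 : a - a' = 0 := Submodule.disjoint_def.1 hV.disjoint _ (sub_mem ha ha')
    (h1 ▸ sub_mem hb' hb)
  refine ⟨sub_eq_zero.1 h2, ?_⟩
  rw [h2, eq_comm, sub_eq_zero] at h1
  exact h1.symm

variable (hA : Algebra.adjoin F (Set.range gen) = ⊤) (hV : IsSupermodule (gradedPart gen par) V)
include hA hV

theorem exists_smul_eq_add (a : A) {e : ZMod 2} {v : M} (hv : v ∈ V e) :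
    ∃ a₀ a₁ : A, a₀ • v ∈ V 0 ∧ a₁ • v ∈ V 1 ∧ a • v = a₀ • v + a₁ • v := by
  have : a ∈ gradedPart (F := F) gen par 0 ⊔ gradedPart gen par 1 := by
    rw [gradedPart_sup hA]; trivial
  obtain ⟨b, hb, b', hb', rfl⟩ := Submodule.mem_sup.1 this
  have h0 := hV.smul_mem _ _ b hb v hv
  have h1 := hV.smul_mem _ _ b' hb' v hv
  have he : ∀ d : ZMod 2, d = 0 ∨ d = 1 := by decide
  rcases he e with rfl | rfl
  · exact ⟨b, b', h0, h1, add_smul _ _ _⟩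
  · exact ⟨b', b, h1, h0, by rw [add_smul, add_comm]⟩

theorem isGradedSubmodule_span_singleton {e : ZMod 2} {v : M} (hv : v ∈ V e) :
    IsGradedSubmodule V (Submodule.span A {v}) := by
  intro w hw
  obtain ⟨a, rfl⟩ := Submodule.mem_span_singleton.1 hw
  obtain ⟨b, b', h0, h1, h⟩ := exists_smul_eq_add hA hV a hv
  exact ⟨b • v, h0, b' • v, h1, Submodule.smul_mem _ _ (Submodule.mem_span_singleton_self v),
    Submodule.smul_mem _ _ (Submodule.mem_span_singleton_self v), h⟩

/-- A nonzero homogeneous vector generates a graded submodule, hence the whole module. This supplies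
the finite dimensionality that the definition of finite weights does not demand. -/
theorem finiteDimensional_of_irreducible [FiniteDimensional F A] [IsScalarTower F A M]
    (hI : IsIrreducibleSupermodule (gradedPart gen par) V) : FiniteDimensional F M := by
  have := hI.nontrivial
  obtain ⟨e, v, hv, hv0⟩ : ∃ e, ∃ v ∈ V e, v ≠ 0 := by
    obtain ⟨w, hw⟩ := exists_ne (0 : M)
    obtain ⟨a, ha, b, hb, rfl⟩ := exists_add_of_isCompl hV.isCompl w
    by_cases ha0 : a = 0
    · exact ⟨1, b, hb, by rintro rfl; exact hw (by simp [ha0])⟩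
    · exact ⟨0, a, ha, ha0⟩
  have h1 := (hI.eq_bot_or_eq_top _ (isGradedSubmodule_span_singleton hA hV hv)).resolve_left
    (by simpa using hv0)
  refine FiniteDimensional.of_surjective ((LinearMap.toSpanSingleton A M v).restrictScalars F)
    fun w => ?_
  have : w ∈ Submodule.span A {v} := by rw [h1]; trivial
  obtain ⟨a, rfl⟩ := Submodule.mem_span_singleton.1 this
  exact ⟨a, rfl⟩

end Graded

/-! ### Irreducible subquotients -/

section IrreducibleSubquotient

variable {F : Type*} [Field F] {A : Type*} [Ring A] [Algebra F A] {G : Type*} {gen : G → A}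
  {par : G → ZMod 2} {M : Type u} [AddCommGroup M] [Module F M] [Module A M] [IsScalarTower F A M]
  {V : ZMod 2 → Submodule F M}

/-- A homogeneous vector of a finite dimensional supermodule survives in some irreducible
subquotient. -/
theorem exists_irreducible_subquotient [FiniteDimensional F M]
    (hA : Algebra.adjoin F (Set.range gen) = ⊤)
    (hV : IsSupermodule (gradedPart gen par) V) {e : ZMod 2} {v : M} (hv : v ∈ V e) (hv0 : v ≠ 0) :
    ∃ (M' : Type u) (_ : AddCommGroup M') (_ : Module F M') (_ : Module A M')
      (_ : IsScalarTower F A M') (V' : ZMod 2 → Submodule F M') (v' : M'),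
      FiniteDimensional F M' ∧ IsIrreducibleSupermodule (gradedPart gen par) V' ∧ v' ≠ 0 ∧
      (∀ a : A, a • v = 0 → a • v' = 0) ∧
      ∀ a : A, (∀ b : A, a • b • v = 0) → ∀ m : M', a • m = 0 := by
  have hN : IsNoetherian A M := isNoetherian_of_tower F inferInstance
  -- N is maximal among graded submodules avoiding v; the submodule P of M/N generated by the image
  -- of v will be irreducible.
  obtain ⟨N, ⟨hNg, hNv⟩, hNmax⟩ := set_has_maximal_iff_noetherian.2 hN
    {N : Submodule A M | IsGradedSubmodule V N ∧ v ∉ N}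
    ⟨⊥, fun w hw => ⟨0, zero_mem _, 0, zero_mem _, zero_mem _, zero_mem _, by simpa using hw⟩,
      by simpa using hv0⟩
  let P : Submodule A (M ⧸ N) := Submodule.span A {N.mkQ v}
  let V' : ZMod 2 → Submodule F P := fun d =>
    ((V d).map (N.mkQ.restrictScalars F)).comap (P.subtype.restrictScalars F)
  have memV' : ∀ d (m : P), m ∈ V' d ↔ ∃ w ∈ V d, N.mkQ w = m := fun d m => Iff.rfl
  let v' : P := ⟨N.mkQ v, Submodule.mem_span_singleton_self _⟩
  have hP : ∀ m : P, ∃ b : A, b • v' = m := by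
    rintro ⟨m, hm⟩
    obtain ⟨b, rfl⟩ := Submodule.mem_span_singleton.1 hm
    exact ⟨b, rfl⟩
  have hv'0 : v' ≠ 0 := by
    intro h
    have : N.mkQ v = 0 := congrArg Subtype.val h
    rw [Submodule.mkQ_apply, Submodule.Quotient.mk_eq_zero] at this
    exact hNv this
  have hcompl : IsCompl (V' 0) (V' 1) := by
    refine ⟨Submodule.disjoint_def.2 ?_, codisjoint_iff.2 (eq_top_iff.2 ?_)⟩
    · intro m h0 h1
      obtain ⟨a, ha, ha'⟩ := (memV' _ _).1 h0
      obtain ⟨b, hb, hb'⟩ := (memV' _ _).1 h1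
      have hab : a - b ∈ N := by
        rw [← Submodule.Quotient.mk_eq_zero, ← Submodule.mkQ_apply, map_sub, ha', hb', sub_self]
      obtain ⟨w₀, hw₀, w₁, hw₁, h2, _, h4⟩ := hNg _ hab
      rw [sub_eq_add_neg] at h4
      have h5 := (eq_and_eq_of_add_eq_add hV.isCompl ha hw₀ (neg_mem hb) hw₁ h4).1
      apply Subtype.ext
      rw [← ha', h5]
      simpa using h2
    · intro m _
      obtain ⟨b, rfl⟩ := hP m
      obtain ⟨b₀, b₁, h0, h1, h⟩ := exists_smul_eq_add hA hV b hv
      refine Submodule.mem_sup.2 ⟨b₀ • v', ⟨_, h0, rfl⟩, b₁ • v', ⟨_, h1, rfl⟩, ?_⟩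
      apply Subtype.ext
      change b₀ • N.mkQ v + b₁ • N.mkQ v = b • N.mkQ v
      rw [← map_smul, ← map_smul, ← map_smul, ← map_add, h]
  have hV' : IsSupermodule (gradedPart gen par) V' := by
    refine ⟨hcompl, fun d e' a ha m hm => ?_⟩
    obtain ⟨w, hw, hw'⟩ := (memV' _ _).1 hm
    refine (memV' _ _).2 ⟨a • w, hV.smul_mem _ _ _ ha _ hw, ?_⟩
    rw [map_smul, hw']
    rfl
  refine ⟨P, inferInstance, inferInstance, inferInstance, inferInstance, V', v', ?_,
    ⟨hV', ⟨v', 0, hv'0⟩, ?_⟩, hv'0, ?_, ?_⟩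
  · have : FiniteDimensional F (M ⧸ N) := Module.Finite.of_surjective (N.mkQ.restrictScalars F)
      N.mkQ_surjective
    exact FiniteDimensional.of_injective (P.subtype.restrictScalars F) Subtype.val_injective
  · intro K hK
    -- The preimage of a graded submodule of P either contains v, so that the submodule is
    -- everything, or avoids v and equals N by maximality.
    let K' : Submodule A M := (K.map P.subtype).comap N.mkQ
    have memK' : ∀ w, w ∈ K' ↔ ∃ k ∈ K, (k : M ⧸ N) = N.mkQ w := fun w => Iff.rfl
    have hNK : N ≤ K' := fun w hw => (memK' w).2 ⟨0, zero_mem _, by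
      rw [Submodule.mkQ_apply, (Submodule.Quotient.mk_eq_zero N).2 hw]; rfl⟩
    have hK'g : IsGradedSubmodule V K' := by
      intro w hw
      obtain ⟨k, hk, hkw⟩ := (memK' w).1 hw
      obtain ⟨k₀, hk₀, k₁, hk₁, h0, h1, rfl⟩ := hK k hk
      obtain ⟨w₀, hw₀, e₀⟩ := (memV' _ _).1 hk₀
      obtain ⟨w₁, hw₁, e₁⟩ := (memV' _ _).1 hk₁
      have hN' : w - w₀ - w₁ ∈ N := by
        rw [← Submodule.Quotient.mk_eq_zero, ← Submodule.mkQ_apply, map_sub, map_sub, ← hkw, e₀,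
          e₁]
        change (k₀ : M ⧸ N) + k₁ - k₀ - k₁ = 0
        abel
      obtain ⟨n₀, hn₀, n₁, hn₁, i0, i1, hn⟩ := hNg _ hN'
      refine ⟨w₀ + n₀, add_mem hw₀ hn₀, w₁ + n₁, add_mem hw₁ hn₁,
        add_mem ((memK' _).2 ⟨k₀, h0, e₀.symm⟩) (hNK i0),
        add_mem ((memK' _).2 ⟨k₁, h1, e₁.symm⟩) (hNK i1), ?_⟩
      rw [sub_sub, sub_eq_iff_eq_add] at hn
      rw [hn]; abel
    by_cases hvK : v ∈ K'
    · right
      obtain ⟨k, hk, hkv⟩ := (memK' v).1 hvK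
      have : k = v' := Subtype.ext hkv
      subst this
      rw [eq_top_iff]
      intro m _
      obtain ⟨b, rfl⟩ := hP m
      exact K.smul_mem _ hk
    · left
      have hKN : K' = N := by
        by_contra hne
        exact hNmax K' ⟨hK'g, hvK⟩ (lt_of_le_of_ne hNK (Ne.symm hne))
      rw [eq_bot_iff]
      intro m hm
      obtain ⟨w, hw⟩ := N.mkQ_surjective m
      have hw2 : w ∈ N := hKN ▸ (memK' w).2 ⟨m, hm, hw.symm⟩
      rw [Submodule.mem_bot]
      apply Subtype.ext
      rw [← hw]
      simpa using hw2
  · intro a ha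
    apply Subtype.ext
    change a • N.mkQ v = 0
    rw [← map_smul, ha, map_zero]
  · intro a ha m
    obtain ⟨b, rfl⟩ := hP m
    apply Subtype.ext
    change a • b • N.mkQ v = 0
    rw [← map_smul, ← map_smul, ha, map_zero]

end IrreducibleSubquotient

/-! ### Finite dimensionality of the finite Hecke-Clifford algebra -/

section FiniteDimensionality

variable (F : Type u) [Field F] (n : ℕ)

theorem adjoin_range_finiteGen : Algebra.adjoin F (Set.range (finiteGen F n)) = ⊤ :=
  adjoin_range_mkAlgHom _

/-- The span of the ordered products of distinct Clifford generators with indices below `m`. -/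
noncomputable def cliffordSpan : ℕ → Submodule F (FiniteHeckeClifford F n)
  | 0 => Submodule.span F {1}
  | m + 1 => cliffordSpan m ⊔ (if h : m < n then
      (cliffordSpan m).map (LinearMap.mulLeft F (finiteC F n ⟨m, h⟩)) else ⊥)

variable {F n}

theorem cliffordSpan_fg (m : ℕ) : (cliffordSpan F n m).FG := by
  induction m with
  | zero => exact Submodule.fg_span_singleton _
  | succ m ih =>
    rw [cliffordSpan]
    refine ih.sup ?_
    split_ifs
    · exact ih.map _
    · exact Submodule.fg_bot

theorem one_mem_cliffordSpan (m : ℕ) : 1 ∈ cliffordSpan F n m := by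
  induction m with
  | zero => exact Submodule.mem_span_singleton_self _
  | succ m ih => exact Submodule.mem_sup_left ih

theorem finiteC_mul_mem_cliffordSpan (m : ℕ) (j : Fin n) (hj : (j : ℕ) < m)
    {a : FiniteHeckeClifford F n} (ha : a ∈ cliffordSpan F n m) :
    finiteC F n j * a ∈ cliffordSpan F n m := by
  induction m generalizing a with
  | zero => omega
  | succ m ih =>
    have S := finiteSystem_finiteGen F n
    rw [cliffordSpan] at ha ⊢
    obtain ⟨b, hb, d, hd, rfl⟩ := Submodule.mem_sup.1 ha
    rw [mul_add]
    by_cases hm : m < n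
    · rw [dif_pos hm] at hd ⊢
      obtain ⟨e, he, rfl⟩ := hd
      rw [LinearMap.mulLeft_apply]
      by_cases hjm : (j : ℕ) = m
      · obtain rfl : j = ⟨m, hm⟩ := Fin.ext hjm
        rw [S.c_mul_self_mul, add_comm]
        exact Submodule.add_mem_sup he ⟨b, hb, rfl⟩
      · rw [S.c_mul_c_mul (j := ⟨m, hm⟩) fun h => hjm (by rw [h])]
        exact Submodule.add_mem_sup (ih (by omega) hb)
          (neg_mem ⟨_, ih (by omega) he, rfl⟩)
    · rw [dif_neg hm, Submodule.mem_bot] at hd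
      rw [dif_neg hm, hd, mul_zero, add_zero]
      exact Submodule.mem_sup_left (ih (by omega) hb)

instance finiteDimensional_finiteHeckeClifford : FiniteDimensional F (FiniteHeckeClifford F n) := by
  -- The span of the products of a permutation and an ordered Clifford monomial contains 1 and is
  -- stable under left multiplication by the generators.
  let P : Submodule F (FiniteHeckeClifford F n) :=
    ⨆ σ : Equiv.Perm (Fin n), (cliffordSpan F n n).map (LinearMap.mulLeft F (finiteW F n σ))
  have hP : P.FG := Submodule.fg_iSup _ fun σ => (cliffordSpan_fg n).map _
  have S := finiteSystem_finiteGen F n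
  have mem : ∀ σ a, a ∈ cliffordSpan F n n → finiteW F n σ * a ∈ P := fun σ a ha =>
    Submodule.mem_iSup_of_mem σ ⟨a, ha, rfl⟩
  have hgen : ∀ g, ∀ b ∈ P, finiteGen F n g * b ∈ P := by
    intro g b hb
    induction hb using Submodule.iSup_induction' with
    | mem σ b hb =>
      obtain ⟨a, ha, rfl⟩ := hb
      rw [LinearMap.mulLeft_apply, ← mul_assoc]
      cases g with
      | c k =>
        change finiteC F n k * _ * _ ∈ P
        rw [S.c_mul_w, mul_assoc]
        exact mem _ _ (finiteC_mul_mem_cliffordSpan n _ (Fin.is_lt _) ha)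
      | w τ =>
        change finiteW F n τ * _ * _ ∈ P
        rw [← map_mul]
        exact mem _ _ ha
    | zero => rw [mul_zero]; exact zero_mem _
    | add b d _ _ h1 h2 => rw [mul_add]; exact add_mem h1 h2
  have h1 : (1 : FiniteHeckeClifford F n) ∈ P := by
    have := mem 1 1 (one_mem_cliffordSpan n)
    rwa [map_one, one_mul] at this
  have hall : ∀ a : FiniteHeckeClifford F n, ∀ b ∈ P, a * b ∈ P := by
    intro a
    have ha : a ∈ Algebra.adjoin F (Set.range (finiteGen F n)) := by
      rw [adjoin_range_finiteGen]; trivial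
    induction ha using Algebra.adjoin_induction with
    | mem a ha => obtain ⟨g, rfl⟩ := ha; exact hgen g
    | algebraMap r => intro b hb; rw [← Algebra.smul_def]; exact P.smul_mem r hb
    | add a b _ _ h1 h2 => intro d hd; rw [add_mul]; exact add_mem (h1 d hd) (h2 d hd)
    | mul a b _ _ h1 h2 => intro d hd; rw [mul_assoc]; exact h1 _ (h2 d hd)
  have htop : P = ⊤ := eq_top_iff.2 fun a _ => by simpa using hall a 1 h1
  exact ⟨htop ▸ hP⟩

end FiniteDimensionality

/-! ### Finite weights are connected affine weights -/

section Inclusion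

variable {F : Type u} [Field F] {n : ℕ}

theorem weightSpace_eq_sqEigenspace [IsAlgClosed F] {A : Type*} [Ring A] [Algebra F A] {M : Type*}
    [AddCommGroup M] [Module F M] [Module A M] [IsScalarTower F A M] [FiniteDimensional F M]
    {y : Fin n → A} (hy : ∀ k, ActsSemisimply F M (y k)) (i : Fin n → ℕ) :
    weightSpace F M y i = sqEigenspace (fun k => Algebra.lsmul F F M (y k)) fun k => q (i k) := by
  rw [sqEigenspace_eq_iInf_maxGenEigenspace hy]
  simp only [weightSpace, map_pow]

/-- The homomorphism from the affine to the finite Hecke-Clifford algebra which maps the polynomial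
generators to the Jucys-Murphy elements. -/
theorem exists_affine_to_finite (F : Type u) [Field F] (n : ℕ) :
    ∃ f : AffineHeckeClifford F n →ₐ[F] FiniteHeckeClifford F n, Function.Surjective f ∧
      ∀ g, f (affineGen F n g) = affineImage (fun k h => finiteW F n (adjSwap k h))
        (jucysMurphy F n) (finiteC F n) g := by
  obtain ⟨f, hf⟩ := (affineSystem_jucysMurphy F n).exists_hom (F := F)
  refine ⟨f, ?_, hf⟩
  rw [← AlgHom.range_eq_top, eq_top_iff, ← adjoin_range_finiteGen, Algebra.adjoin_le_iff]
  rintro _ ⟨g, rfl⟩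
  cases g with
  | c k => exact ⟨affineGen F n (.c k), hf _⟩
  | w σ =>
    refine perm_induction_adjSwap (P := fun σ => finiteW F n σ ∈ f.range) ?_ (fun σ τ h1 h2 => ?_)
      (fun k h => ⟨affineGen F n (.s k h), hf _⟩) σ
    · rw [map_one]; exact one_mem _
    · rw [map_mul]; exact mul_mem h1 h2

theorem lsmul_affineSystem_jucysMurphy (M : Type*) [AddCommGroup M] [Module F M]
    [Module (FiniteHeckeClifford F n) M] [IsScalarTower F (FiniteHeckeClifford F n) M] :
    AffineSystem (fun k h => Algebra.lsmul F F M (finiteW F n (adjSwap k h)))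
      (fun k => Algebra.lsmul F F M (jucysMurphy F n k))
      (fun k => Algebra.lsmul F F M (finiteC F n k)) :=
  (affineSystem_jucysMurphy F n).map
    (Algebra.lsmul F F M : FiniteHeckeClifford F n →ₐ[F] Module.End F M).toRingHom

theorem weightsOfFiniteModules_subset [IsAlgClosed F] {p : ℕ} [CharP F p] (hp : p ≠ 2) :
    weightsOfFiniteModules F n p ⊆ finiteWeights F n p := by
  rintro i ⟨hi, M, _, _, _, _, V, hI, hss, hw⟩
  have hfd : FiniteDimensional F M :=
    finiteDimensional_of_irreducible (adjoin_range_finiteGen F n) hI.toIsSupermodule hI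
  have S := lsmul_affineSystem_jucysMurphy (F := F) (n := n) M
  have h0 : ∀ k : Fin n, (k : ℕ) = 0 → Algebra.lsmul F F M (jucysMurphy F n k) = 0 :=
    fun k hk => by rw [jucysMurphy_zero k hk, map_zero]
  have hw' := hw
  rw [weightSpace_eq_sqEigenspace hss] at hw'
  obtain ⟨v, hv, hv0⟩ := Submodule.exists_mem_ne_zero_of_ne_bot hw'
  obtain ⟨f, hf, hfg⟩ := exists_affine_to_finite F n
  have hfx : ∀ k, f (affineX F n k) = jucysMurphy F n k := fun k => hfg _
  refine ⟨⟨hi, M, inferInstance, inferInstance, Module.compHom M f.toRingHom, ?_⟩,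
    fun k hk => weight_eq_zero hp h0 hi hv hv0 k hk, ?_⟩
  · let _ : Module (AffineHeckeClifford F n) M := Module.compHom M f.toRingHom
    have hsm : ∀ (a : AffineHeckeClifford F n) (m : M), a • m = f a • m := fun _ _ => rfl
    have hT : IsScalarTower F (AffineHeckeClifford F n) M :=
      ⟨fun r a m => by rw [hsm, hsm, map_smul, smul_assoc]⟩
    have hl : ∀ a : AffineHeckeClifford F n,
        Algebra.lsmul F F M a = Algebra.lsmul F F M (f a) := fun a => rfl
    refine ⟨hT, V, hfd, ?_, ?_, ?_, ?_⟩
    · intro k μ hμ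
      rw [hl, map_pow, map_pow, hfx] at hμ
      exact S.exists_q_of_hasEigenvalue hss hp h0 k k.2 μ hμ
    · refine ⟨isSupermodule_of_gen hI.isCompl ?_, hI.nontrivial, ?_⟩
      · intro g e v hv
        rw [hsm, hfg]
        cases g with
        | s k h => exact hI.smul_mem _ _ _ (gen_mem_gradedPart (FiniteGen.w _)) v hv
        | x k =>
          change jucysMurphy F n k • v ∈ V (0 + e)
          rw [jucysMurphy, Finset.sum_smul]
          refine sum_mem fun j _ => ?_
          have h1 := hI.smul_mem _ _ _ (gen_mem_gradedPart (FiniteGen.w (Equiv.swap j k))) v hv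
          have h2 := hI.smul_mem _ _ _ (gen_mem_gradedPart (FiniteGen.c k)) _ h1
          have h3 := hI.smul_mem _ _ _ (gen_mem_gradedPart (FiniteGen.c j)) _ h2
          simp only [FiniteGen.parity] at h1 h2 h3
          rw [← add_assoc, show (1 + 1 : ZMod 2) = 0 by decide, zero_add] at h3
          rw [mul_smul, add_smul, one_smul, mul_smul]
          rw [zero_add] at h3
          rw [zero_add] at h1 ⊢
          exact add_mem h1 h3
        | c k => exact hI.smul_mem _ _ _ (gen_mem_gradedPart (FiniteGen.c k)) v hv
      · intro N hN
        -- Surjectivity of f makes every submodule over the affine algebra one over the finite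
        -- algebra, so irreducibility is inherited by the pullback.
        let N' : Submodule (FiniteHeckeClifford F n) M :=
          { N.toAddSubmonoid with
            smul_mem' := fun a m hm => by
              obtain ⟨b, rfl⟩ := hf a
              exact N.smul_mem b hm }
        rcases hI.eq_bot_or_eq_top N' hN with h | h
        · left
          rw [eq_bot_iff]
          intro m hm
          have : m ∈ N' := hm
          rw [h] at this
          exact this
        · right
          rw [eq_top_iff]
          intro m _
          have : m ∈ N' := by rw [h]; trivial
          exact this
    · intro k
      rw [ActsSemisimply, hl, hfx]
      exact hss k
    · convert hw using 1
      simp only [weightSpace, hl, map_pow, hfx]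
  · intro k hk
    obtain ⟨m, hm⟩ : ∃ m, (k : ℕ) = m + 1 := ⟨k - 1, by omega⟩
    have hmn : m + 1 < n := by omega
    obtain rfl : k = HeckeClifford.hi m hmn := Fin.ext hm
    obtain ⟨j, hj, hj2⟩ := S.weight_connected hss hp h0 m hmn hi hv hv0
    refine ⟨(i j : ℤ), ?_, ⟨j, hj, rfl⟩⟩
    simp only [Set.mem_insert_iff, Set.mem_singleton_iff]
    omega

end Inclusion

/-! ### The parity operator -/

section Parity

variable {F : Type*} [Field F] {M : Type*} [AddCommGroup M] [Module F M]
  {V : ZMod 2 → Submodule F M}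

/-- Commutation with ε replaces evenness. The twisted operators are defined one eigenspace at a
time, not as images of even algebra elements, so their evenness is obtained in this way. -/
theorem exists_parity (hV : IsCompl (V 0) (V 1)) :
    ∃ ε : Module.End F M, (∀ v ∈ V 0, ε v = v) ∧ ∀ v ∈ V 1, ε v = -v :=
  ⟨LinearMap.ofIsCompl hV (V 0).subtype (-(V 1).subtype),
    fun v hv => LinearMap.ofIsCompl_apply_left hV ⟨v, hv⟩,
    fun v hv => LinearMap.ofIsCompl_apply_right hV ⟨v, hv⟩⟩

variable (hV : IsCompl (V 0) (V 1)) {ε : Module.End F M} (h0 : ∀ v ∈ V 0, ε v = v)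
  (h1 : ∀ v ∈ V 1, ε v = -v)
include hV h0 h1

theorem commute_parity {a : Module.End F M} (ha : ∀ e, ∀ v ∈ V e, a v ∈ V e) : Commute ε a := by
  refine LinearMap.ext fun v => ?_
  obtain ⟨v₀, hv₀, v₁, hv₁, rfl⟩ := exists_add_of_isCompl hV v
  simp only [Module.End.mul_apply, map_add, h0 _ hv₀, h1 _ hv₁, h0 _ (ha _ _ hv₀),
    h1 _ (ha _ _ hv₁), map_neg]

theorem parity_mul_odd {a : Module.End F M} (ha : ∀ e, ∀ v ∈ V e, a v ∈ V (1 + e)) :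
    ε * a = -(a * ε) := by
  refine LinearMap.ext fun v => ?_
  obtain ⟨v₀, hv₀, v₁, hv₁, rfl⟩ := exists_add_of_isCompl hV v
  simp only [Module.End.mul_apply, LinearMap.neg_apply, map_add, h0 _ hv₀, h1 _ hv₁,
    h1 _ (ha _ _ hv₀), h0 _ (ha _ _ hv₁), map_neg]
  abel

theorem mem_of_commute_parity (h2 : (2 : F) ≠ 0) {a : Module.End F M} (ha : Commute ε a) :
    ∀ e, ∀ v ∈ V e, a v ∈ V e := by
  have hcases : ∀ e : ZMod 2, e = 0 ∨ e = 1 := by decide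
  intro e v hv
  have h3 : ε (a v) = a (ε v) := LinearMap.congr_fun ha.eq v
  obtain ⟨w₀, hw₀, w₁, hw₁, hw⟩ := exists_add_of_isCompl hV (a v)
  have hz : ∀ w : M, w = -w → w = 0 := fun w hw => by
    have : (2 : F) • w = 0 := by rw [two_smul]; nth_rewrite 1 [hw]; simp
    exact (smul_eq_zero.1 this).resolve_left h2
  rcases hcases e with rfl | rfl
  · rw [h0 v hv, hw, map_add, h0 _ hw₀, h1 _ hw₁] at h3
    rw [hw, hz w₁ (add_left_cancel h3).symm, add_zero]
    exact hw₀
  · rw [h1 v hv, map_neg, hw, map_add, h0 _ hw₀, h1 _ hw₁, neg_add] at h3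
    rw [hw, hz w₀ (add_right_cancel h3), zero_add]
    exact hw₁

end Parity

/-! ### Connected weights -/

section Combinatorics

/-- The combinatorial condition which singles out the weights of the finite Hecke-Clifford
algebra. -/
structure IsConnectedWeight (p : ℕ) {n : ℕ} (l : Fin n → ℕ) : Prop where
  mem : ∀ k, l k ∈ indexSet p
  zero : ∀ k : Fin n, (k : ℕ) = 0 → l k = 0
  conn : ∀ k : Fin n, 0 < (k : ℕ) → ∃ j : Fin n, j < k ∧ (l j = l k + 1 ∨ l k = l j + 1)

/-- The earlier neighbour of the entry at k + 1 is not at position k, so it lies before both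
exchanged positions and survives the exchange; in particular k > 0, which protects the leading 0. -/
theorem IsConnectedWeight.comp_adjSwap {p n : ℕ} {l : Fin n → ℕ} (hl : IsConnectedWeight p l)
    {k : ℕ} {h : k + 1 < n} (h1 : l (lo k h) ≠ l (hi k h) + 1) (h2 : l (hi k h) ≠ l (lo k h) + 1) :
    IsConnectedWeight p (l ∘ adjSwap k h) := by
  have hlo : adjSwap k h (lo k h) = hi k h := adjSwap_apply_left k h
  have hhi : adjSwap k h (hi k h) = lo k h := adjSwap_apply_right k h
  have hhi_conn : ∃ j : Fin n, j < lo k h ∧ (l j = l (hi k h) + 1 ∨ l (hi k h) = l j + 1) := by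
    obtain ⟨j, hj, hj2⟩ := hl.conn (hi k h) (Nat.succ_pos k)
    refine ⟨j, lt_of_le_of_ne (Nat.le_of_lt_succ hj) ?_, hj2⟩
    rintro rfl
    tauto
  have hk : 0 < k := by
    obtain ⟨j, hj, -⟩ := hhi_conn
    exact Nat.zero_lt_of_lt hj
  refine ⟨fun _ => hl.mem _, fun j hj => ?_, fun j hj => ?_⟩
  · rw [Function.comp_apply, adjSwap_apply_of_ne k h (by omega) (by omega)]
    exact hl.zero j hj
  · by_cases hjk : (j : ℕ) = k
    · obtain rfl : j = lo k h := Fin.ext hjk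
      obtain ⟨m, hm, hm2⟩ := hhi_conn
      have hm' : (m : ℕ) < k := hm
      refine ⟨m, hm, ?_⟩
      rwa [Function.comp_apply, Function.comp_apply, hlo,
        adjSwap_apply_of_ne k h (by omega) (by omega)]
    · by_cases hjk' : (j : ℕ) = k + 1
      · obtain rfl : j = hi k h := Fin.ext hjk'
        obtain ⟨m, hm, hm2⟩ := hl.conn (lo k h) hk
        have hm' : (m : ℕ) < k := hm
        refine ⟨m, lt_trans hm (Nat.lt_succ_self k), ?_⟩
        rwa [Function.comp_apply, Function.comp_apply, hhi,
          adjSwap_apply_of_ne k h (by omega) (by omega)]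
      · obtain ⟨m, hm, hm2⟩ := hl.conn j hj
        have hm' : (m : ℕ) < j := hm
        rw [Function.comp_apply, adjSwap_apply_of_ne k h hjk hjk']
        refine ⟨adjSwap k h m, ?_, ?_⟩
        · by_cases e1 : (m : ℕ) = k
          · obtain rfl : m = lo k h := Fin.ext e1
            rw [hlo, Fin.lt_def]
            change k + 1 < (j : ℕ)
            omega
          · by_cases e2 : (m : ℕ) = k + 1
            · obtain rfl : m = hi k h := Fin.ext e2
              rw [hhi, Fin.lt_def]
              change k < (j : ℕ)
              omega
            · rwa [adjSwap_apply_of_ne k h e1 e2]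
        · rwa [Function.comp_apply, ← Equiv.Perm.mul_apply, adjSwap_mul_self]

theorem isConnectedWeight_of_mem_finiteWeights {F : Type u} [Field F] {p n : ℕ} {l : Fin n → ℕ}
    (hl : l ∈ finiteWeights F n p) : IsConnectedWeight p l := by
  refine ⟨hl.1.1, hl.2.1, fun k hk => ?_⟩
  obtain ⟨_, h, j, hj, rfl⟩ := hl.2.2 k hk
  refine ⟨j, hj, ?_⟩
  simp only [Set.mem_insert_iff, Set.mem_singleton_iff] at h
  omega

end Combinatorics

/-! ### The twisted module over the finite algebra -/

section TwistedModule

/-- Carries the minimal polynomial of a polynomial generator over to the corresponding Jucys-Murphy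
element on `connectedPart`. -/
theorem aeval_apply_eq_of_eqOn {F : Type*} [Field F] {M : Type*} [AddCommGroup M] [Module F M]
    {N : Submodule F M} {f g : Module.End F M} (hg : ∀ v ∈ N, g v ∈ N) (hfg : ∀ v ∈ N, f v = g v)
    (P : Polynomial F) {v : M} (hv : v ∈ N) :
    Polynomial.aeval f P v = Polynomial.aeval g P v := by
  have hpow : ∀ m : ℕ, (g ^ m) v ∈ N ∧ (f ^ m) v = (g ^ m) v := by
    intro m
    induction m with
    | zero => exact ⟨hv, rfl⟩
    | succ m ih =>
      rw [pow_succ', pow_succ', Module.End.mul_apply, Module.End.mul_apply, ih.2]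
      exact ⟨hg _ ih.1, hfg _ ih.1⟩
  simp only [Polynomial.aeval_eq_sum_range, LinearMap.sum_apply, LinearMap.smul_apply, (hpow _).2]

variable {F : Type u} [Field F] {p : ℕ} {M : Type u} [AddCommGroup M] [Module F M] {n : ℕ}
  {s : ∀ k, k + 1 < n → Module.End F M}
  {x c : Fin n → Module.End F M} {T : ∀ k, k + 1 < n → Module.End F M}

variable (p) in
/-- The sum of the eigenspaces for the connected weights. -/
def connectedPart (x : Fin n → Module.End F M) : Submodule F M :=
  ⨆ (l : Fin n → ℕ) (_ : IsConnectedWeight p l), sqEigenspace x fun k => q (l k)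

theorem mem_connectedPart {l : Fin n → ℕ} (hl : IsConnectedWeight p l) {v : M}
    (hv : v ∈ sqEigenspace x fun k => q (l k)) : v ∈ connectedPart p x :=
  Submodule.mem_iSup_of_mem l (Submodule.mem_iSup_of_mem hl hv)

theorem connectedPart_induction {N : Submodule F M}
    (h : ∀ l : Fin n → ℕ, IsConnectedWeight p l → sqEigenspace x (fun k => q (l k)) ≤ N) :
    connectedPart p x ≤ N :=
  iSup_le fun l => iSup_le fun hl => h l hl

theorem x_zero_connectedPart (hx : ∀ k, (x k).IsSemisimple) (k : Fin n) (hk : (k : ℕ) = 0) {v : M}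
    (hv : v ∈ connectedPart p x) : x k v = 0 := by
  have : connectedPart p x ≤ LinearMap.ker (x k) := connectedPart_induction fun l hl v hv => by
    refine apply_eq_zero_of_apply_apply_eq_zero (hx k) ?_
    rw [mem_sqEigenspace.1 hv, hl.zero k hk]
    simp [q]
  exact this hv

namespace AffineSystem

variable (A : AffineSystem s x c)
include A

theorem x_mem_connectedPart (k : Fin n) {v : M} (hv : v ∈ connectedPart p x) :
    x k v ∈ connectedPart p x := by
  have : connectedPart p x ≤ (connectedPart p x).comap (x k) :=
    connectedPart_induction fun l hl v hv => mem_connectedPart hl (A.x_mem hv k)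
  exact this hv

theorem c_mem_connectedPart (k : Fin n) {v : M} (hv : v ∈ connectedPart p x) :
    c k v ∈ connectedPart p x := by
  have : connectedPart p x ≤ (connectedPart p x).comap (c k) :=
    connectedPart_induction fun l hl v hv => mem_connectedPart hl (A.c_mem hv k)
  exact this hv

/-- T leaves an eigenspace only when the pair is unlinked; the two entries are then not consecutive
integers and may be exchanged without losing connectedness. -/
theorem twist_mem_connectedPart (hT : IsTwist s x c T) (k : ℕ) (h : k + 1 < n) {v : M}
    (hv : v ∈ connectedPart p x) : T k h v ∈ connectedPart p x := by
  have : connectedPart p x ≤ (connectedPart p x).comap (T k h) :=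
    connectedPart_induction fun l hl v hv => by
      refine hT.mem (A := A) hv k h (fun w hw => mem_connectedPart hl hw) fun hne w hw => ?_
      refine mem_connectedPart (hl.comp_adjSwap ?_ ?_) hw
      · intro e
        rw [e] at hne
        apply hne
        have := q_linked_of_succ (F := F) (l (hi k h))
        linear_combination this
      · intro e
        rw [e] at hne
        exact hne (q_linked_of_succ _)
  exact this hv

variable [IsAlgClosed F] [CharP F p] [FiniteDimensional F M]

/-- On the sum of the eigenspaces for connected weights the Jucys-Murphy elements of the twisted
action coincide with the polynomial generators. -/
theorem jucysMurphy_apply_eq (hp : p ≠ 2) (hx : ∀ k, (x k).IsSemisimple)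
    (hT : IsTwist s x c T) {g : FiniteHeckeClifford F n →ₐ[F] Module.End F M}
    (hgT : ∀ k h, g (finiteW F n (adjSwap k h)) = T k h) (hgc : ∀ k, g (finiteC F n k) = c k)
    (k : ℕ) (hk : k < n) {v : M} (hv : v ∈ connectedPart p x) :
    g (jucysMurphy F n ⟨k, hk⟩) v = x ⟨k, hk⟩ v := by
  have h2 : (2 : F) ≠ 0 := two_ne_zero_of_char_ne_two hp
  induction k generalizing v with
  | zero =>
    rw [jucysMurphy_zero _ rfl, map_zero, x_zero_connectedPart hx _ rfl hv, LinearMap.zero_apply]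
  | succ k ih =>
    have S := (affineSystem_jucysMurphy F n).map g.toRingHom
    -- The next Jucys-Murphy element and the next x satisfy the same relation with T. Evaluated at T
    -- v it expresses their values at v, because T² = 1, and T v stays where the induction
    -- hypothesis holds.
    have e1 := LinearMap.congr_fun (S.s_x k hk) (T k hk v)
    have e2 := LinearMap.congr_fun (hT.mul_x A hx h2 k hk) (T k hk v)
    have e3 : ∀ w, T k hk (T k hk w) = w := LinearMap.congr_fun (hT.mul_self A hx h2 k hk)
    simp only [AlgHom.toRingHom_eq_coe, RingHom.coe_coe, hgT, hgc, Module.End.mul_apply,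
      LinearMap.sub_apply, e3] at e1 e2
    rw [ih (by omega) (A.twist_mem_connectedPart hT k hk hv), e2] at e1
    exact (sub_left_injective e1).symm

end AffineSystem

variable [IsAlgClosed F] [CharP F p] [FiniteDimensional F M]

theorem exists_finite_hom_of_twist {A : AffineSystem s x c} (hp : p ≠ 2)
    (hx : ∀ k, (x k).IsSemisimple) (hT : AffineSystem.IsTwist s x c T) :
    ∃ g : FiniteHeckeClifford F n →ₐ[F] Module.End F M,
      (∀ k h, g (finiteW F n (adjSwap k h)) = T k h) ∧ ∀ k, g (finiteC F n k) = c k := by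
  have h2 : (2 : F) ≠ 0 := two_ne_zero_of_char_ne_two hp
  obtain ⟨ρ, hρ⟩ := exists_perm_hom n T (fun k h => hT.mul_self A hx h2 k h)
    (fun k l hk hl hkl => hT.commute_far A hx hk hl hkl) (fun k h h' => hT.braid A hx h2 k h h')
  have S : FiniteSystem ρ c := by
    refine ⟨A.c_sq, A.c_anticomm, fun σ => ?_⟩
    refine perm_induction_adjSwap (P := fun σ => ∀ i, ρ σ * c i = c (σ i) * ρ σ) (by simp)
      (fun σ τ h1 h2 i => ?_) (fun k h i => ?_) σ
    · rw [map_mul, mul_assoc, h2, ← mul_assoc, h1, mul_assoc, Equiv.Perm.mul_apply]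
    · rw [hρ]
      exact hT.mul_c A hx k h i
  obtain ⟨g, hg⟩ := S.exists_hom (F := F)
  exact ⟨g, fun k h => (hg _).trans (hρ k h), fun k => hg _⟩

end TwistedModule

/-! ### Connected affine weights are finite weights -/

variable {F : Type u} [Field F] {n : ℕ}

theorem map_mem_of_gen {M : Type*} [AddCommGroup M] [Module F M]
    {g : FiniteHeckeClifford F n →ₐ[F] Module.End F M} {N : Submodule F M}
    (hs : ∀ k h, ∀ v ∈ N, g (finiteW F n (adjSwap k h)) v ∈ N)
    (hc : ∀ k, ∀ v ∈ N, g (finiteC F n k) v ∈ N) (a : FiniteHeckeClifford F n) :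
    ∀ v ∈ N, g a v ∈ N := by
  have ha : a ∈ Algebra.adjoin F (Set.range (finiteGen F n)) := by
    rw [adjoin_range_finiteGen]; trivial
  induction ha using Algebra.adjoin_induction with
  | mem a ha =>
    obtain ⟨b, rfl⟩ := ha
    cases b with
    | c k => exact hc k
    | w σ =>
      change ∀ v ∈ N, g (finiteW F n σ) v ∈ N
      refine perm_induction_adjSwap (P := fun σ => ∀ v ∈ N, g (finiteW F n σ) v ∈ N) ?_ ?_ hs σ
      · intro v hv; simpa using hv
      · intro σ τ h1 h2 v hv
        rw [map_mul, map_mul]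
        exact h1 _ (h2 _ hv)
  | algebraMap r =>
    intro v hv
    rw [AlgHom.commutes, Module.algebraMap_end_apply]
    exact N.smul_mem r hv
  | add a b _ _ h1 h2 => intro v hv; rw [map_add]; exact add_mem (h1 v hv) (h2 v hv)
  | mul a b _ _ h1 h2 => intro v hv; rw [map_mul]; exact h1 _ (h2 v hv)

theorem AffineSystem.commute_parity_twist [IsAlgClosed F] {M : Type*} [AddCommGroup M] [Module F M]
    [FiniteDimensional F M] {s : ∀ k, k + 1 < n → Module.End F M}
    {x c : Fin n → Module.End F M} {T : ∀ k, k + 1 < n → Module.End F M}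
    (A : AffineSystem s x c) (hx : ∀ k, (x k).IsSemisimple) (hT : IsTwist s x c T)
    {ε : Module.End F M} (hs : ∀ k h, Commute ε (s k h)) (hεx : ∀ k, Commute ε (x k))
    (hc : ∀ k, ε * c k = -(c k * ε)) (k : ℕ) (h : k + 1 < n) : Commute ε (T k h) := by
  have hcd : Commute ε (c (lo k h) * c (hi k h)) := by
    rw [Commute, SemiconjBy, ← mul_assoc, hc, neg_mul, mul_assoc, hc, mul_neg, neg_neg, mul_assoc]
  exact (hT.mul_eq_mul A hx k h (fun i => ((hεx i).mul_right (hεx i)).symm)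
    (commute_crossing (hεx _) (hεx _) hcd).symm.eq
    (commute_twine (hs k h) (hεx _) (hεx _) hcd).symm.eq).symm

theorem finiteWeights_subset [IsAlgClosed F] {p : ℕ} [CharP F p] (hp : p ≠ 2) :
    finiteWeights F n p ⊆ weightsOfFiniteModules F n p := by
  intro i hi0
  have hconn := isConnectedWeight_of_mem_finiteWeights hi0
  obtain ⟨⟨hi, M, _, _, _, _, V, hfd, -, hI, hss, hw⟩, -⟩ := hi0
  have h2 : (2 : F) ≠ 0 := two_ne_zero_of_char_ne_two hp
  rw [weightSpace_eq_sqEigenspace hss] at hw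
  set x : Fin n → Module.End F M := fun k => Algebra.lsmul F F M (affineX F n k) with hxdef
  have A : AffineSystem (fun k h => Algebra.lsmul F F M (affineGen F n (.s k h))) x
      (fun k => Algebra.lsmul F F M (affineGen F n (.c k))) :=
    (affineSystem_affineGen F n).map
      (Algebra.lsmul F F M : AffineHeckeClifford F n →ₐ[F] Module.End F M).toRingHom
  have hx : ∀ k, (x k).IsSemisimple := hss
  obtain ⟨T, hT⟩ := A.exists_isTwist hx
  obtain ⟨g, hgT, hgc⟩ := exists_finite_hom_of_twist (A := A) hp hx hT
  obtain ⟨ε, hε0, hε1⟩ := exists_parity hI.isCompl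
  have hgen : ∀ b : AffineGen n, ∀ e, ∀ v ∈ V e, affineGen F n b • v ∈ V (b.parity + e) :=
    fun b e v hv => hI.smul_mem _ _ _ (gen_mem_gradedPart b) v hv
  have hεx : ∀ k, Commute ε (x k) := fun k => commute_parity hI.isCompl hε0 hε1 fun e v hv =>
    (zero_add e) ▸ hgen (.x k) e v hv
  have hcV : ∀ k e, ∀ v ∈ V e, g (finiteC F n k) v ∈ V (1 + e) := fun k e v hv => by
    rw [hgc]
    exact hgen (.c k) e v hv
  have hεT : ∀ k h, Commute ε (T k h) := A.commute_parity_twist hx hT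
    (fun k h => commute_parity hI.isCompl hε0 hε1 fun e v hv =>
      (zero_add e) ▸ hgen (.s k h) e v hv) hεx
    fun k => parity_mul_odd hI.isCompl hε0 hε1 fun e v hv => hgen (.c k) e v hv
  let _ : Module (FiniteHeckeClifford F n) M := Module.compHom M g.toRingHom
  have hsm : ∀ (a : FiniteHeckeClifford F n) (m : M), a • m = g a m := fun _ _ => rfl
  have _ : IsScalarTower F (FiniteHeckeClifford F n) M :=
    ⟨fun r a m => by rw [hsm, hsm, map_smul, LinearMap.smul_apply]⟩
  have hV : IsSupermodule (finiteGrading F n) V := by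
    refine isSupermodule_of_gen hI.isCompl fun b e v hv => ?_
    rw [hsm]
    cases b with
    | c k => exact hcV k e v hv
    | w σ =>
      change g (finiteW F n σ) v ∈ V (0 + e)
      rw [zero_add]
      revert v
      refine perm_induction_adjSwap (P := fun σ => ∀ v ∈ V e, g (finiteW F n σ) v ∈ V e)
        (fun v hv => by simpa using hv) (fun σ τ h1 h2 v hv => ?_)
        (fun k h => ?_) σ
      · rw [map_mul, map_mul]
        exact h1 _ (h2 _ hv)
      · rw [hgT]
        exact mem_of_commute_parity hI.isCompl hε0 hε1 h2 (hεT k h) e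
  -- Parity commutes with the x's, so the homogeneous components of a weight vector are weight
  -- vectors; the even one is half of v + ε v.
  obtain ⟨v, hv, hv0, e, hve⟩ : ∃ v ∈ sqEigenspace x (fun k => q (i k)), v ≠ 0 ∧ ∃ e, v ∈ V e := by
    obtain ⟨v, hv, hv0⟩ := Submodule.exists_mem_ne_zero_of_ne_bot hw
    obtain ⟨a, ha, b, hb, rfl⟩ := exists_add_of_isCompl hI.isCompl v
    have hεv := AffineSystem.mem_of_commute (a := ε)
      (fun k => ((hεx k).mul_right (hεx k)).symm) hv
    rw [map_add, hε0 a ha, hε1 b hb] at hεv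
    have ha' : a ∈ sqEigenspace x fun k => q (i k) := by
      have := Submodule.smul_mem _ (2 : F)⁻¹ (add_mem hv hεv)
      rwa [show a + b + (a + -b) = (2 : F) • a by rw [two_smul]; abel, inv_smul_smul₀ h2] at this
    by_cases h : a = 0
    · subst h
      rw [zero_add] at hv hv0
      exact ⟨b, hv, hv0, 1, hb⟩
    · exact ⟨a, ha', h, 0, ha⟩
  have hvN : v ∈ connectedPart p x := mem_connectedPart hconn hv
  have hgN : ∀ a, ∀ v ∈ connectedPart p x, g a v ∈ connectedPart p x :=
    map_mem_of_gen (fun k h v hv => by rw [hgT]; exact A.twist_mem_connectedPart hT k h hv)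
      fun k v hv => by rw [hgc]; exact A.c_mem_connectedPart k hv
  have hJ : ∀ k, ∀ v ∈ connectedPart p x, g (jucysMurphy F n k) v = x k v :=
    fun k v hv => A.jucysMurphy_apply_eq hp hx hT hgT hgc k k.2 hv
  obtain ⟨M', _, _, _, _, V', v', hfd', hI', hv0', hv1, hv2⟩ :=
    exists_irreducible_subquotient (adjoin_range_finiteGen F n) hV hve hv0
  refine ⟨hi, M', inferInstance, inferInstance, inferInstance, inferInstance, V', hI', fun k => ?_,
    ?_⟩
  -- The squarefree minimal polynomial of x k annihilates the Jucys-Murphy element on the submodule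
  -- generated by v, hence on the subquotient.
  · refine Module.End.isSemisimple_of_squarefree_aeval_eq_zero (hx k).minpoly_squarefree
      (LinearMap.ext fun m => ?_)
    rw [Polynomial.aeval_algHom_apply]
    refine hv2 _ (fun b => ?_) m
    rw [hsm, hsm, ← Polynomial.aeval_algHom_apply, aeval_apply_eq_of_eqOn
      (fun v hv => A.x_mem_connectedPart k hv) (hJ k) _ (hgN b v hvN), minpoly.aeval,
      LinearMap.zero_apply]
  · refine (Submodule.ne_bot_iff _).2 ⟨v', ?_, hv0'⟩
    refine Submodule.mem_iInf _ |>.2 fun k => Module.End.mem_maxGenEigenspace _ _ _ |>.2 ⟨1, ?_⟩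
    -- L² - q(i k) kills v, and therefore its image v'; the exponent 1 suffices for the generalized
    -- eigenspace.
    have := hv1 (jucysMurphy F n k ^ 2 - algebraMap F _ (q (i k))) (by
      rw [hsm, map_sub, map_pow, AlgHom.commutes, LinearMap.sub_apply, sq, Module.End.mul_apply,
        hJ k _ hvN, hJ k _ (A.x_mem_connectedPart k hvN), mem_sqEigenspace.1 hv,
        Module.algebraMap_end_apply, sub_self])
    rw [sub_smul, algebraMap_smul] at this
    rwa [pow_one, LinearMap.sub_apply]

end HeckeClifford

theorem mainTheorem7 {F : Type u} [Field F] [IsAlgClosed F] (p : ℕ) [CharP F p] (hp : p ≠ 2)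
    (n : ℕ) :
    HeckeClifford.weightsOfFiniteModules F n p = HeckeClifford.finiteWeights F n p :=
  Set.Subset.antisymm (HeckeClifford.weightsOfFiniteModules_subset hp)
    (HeckeClifford.finiteWeights_subset hp)
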